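/- Let $\theta\ge 2$ and $k\ge 1$ be integers. The hyperrecursive tree with parameter $\theta$ starts at age $0$ with $\theta$ vertices, which form one hyperedge. At each step $n\ge1$ one new vertex is added; given the past, it chooses $\theta-1$ of the $n-1+\theta$ existing vertices, all subsets of that size being equally likely, and the new vertex together with the chosen ones forms a new hyperedge. Let $X_{n,i}$ be the number of vertices that are contained in exactly $i$ hyperedges at age $n$, and let $\Sigma_n^{(\theta)}$ be the $k\times k$ covariance matrix of $(X_{n,1},\dots,X_{n,k})$. Let $s=\theta-1$. Let $A$ be the core matrix of the associated $1$-balanced $(k+1)$-color affine urn with sample size $s$, that is, the $(k+1)\times(k+1)$ matrix whose $i$-th row is the replacement vector $(1-s_1,\,s_1-s_2,\,\dots,\,s_{k-1}-s_k,\,s_k)$ for the sample $(s_1,\dots,s_{k+1})=s\,\mathbf e_i$: $$A=\begin{pmatrix} -(\theta-2)&\theta-1&0&\cdots&0&0\\ 1&-(\theta-1)&\theta-1&\cdots&0&0\\ \vdots&\vdots&\vdots&\ddots&\vdots&\vdots\\ 1&0&0&\cdots&-(\theta-1)&\theta-1\\ 1&0&0&\cdots&0&0\end{pmatrix}.$$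 There is exactly one row vector $v$ with $vA=v$ and $\sum_i v_i=1$ (the normalized principal left eigenvector of $A$). With $\mathbf 1$ the row vector of $k+1$ ones, put $$\hat P=I-\mathbf 1^T v,\qquad B=s^{-2}A^T\bigl(s(s-1)\,v^Tv+s\,\mathrm{diag}(v)\bigr)A .$$ Then the integral $$\Sigma^{(A)}=\int_0^\infty e^{mA^T}\hat P^T B\hat P\,e^{mA}e^{-m}\,dm$$ converges absolutely entrywise and, with $\Sigma_\infty^{(\theta)}$ the upper-left $k\times k$ block of $\Sigma^{(A)}$, $$\Sigma_n^{(\theta)}=n\,\Sigma_\infty^{(\theta)}+\mathbf o(n)\qquad(n\to\infty),$$ where every entry of the matrix $\mathbf o(n)$ is $o(n)$. -/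

import Mathlib

open MeasureTheory ProbabilityTheory Filter Asymptotics

noncomputable section

namespace HyperrecursiveTree

/-! ### The hyperrecursive tree and its containment profile

The vertices are natural numbers: `0, …, θ - 1` are the `θ` originating vertices and `θ + n` is the
vertex added at step `n + 1`, so that at age `n` the vertex set is `Finset.range (θ + n)`.
A sequence `c : ℕ → Finset ℕ` records the choices: `c n` is the set of `θ - 1` existing vertices
chosen by the vertex `θ + n` when it arrives (at step `n + 1`). -/

/-- The hyperedge created at step `n`: `e₀` consists of the originating vertices, and `eₙ₊₁`
consists of the vertex arriving at step `n + 1` and of the vertices that it chooses. -/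
def hyperedge (θ : ℕ) (c : ℕ → Finset ℕ) : ℕ → Finset ℕ
  | 0 => Finset.range θ
  | n + 1 => insert (θ + n) (c n)

/-- The containment level of the vertex `v` at age `n`: the number of the hyperedges
`e₀, …, eₙ` that contain `v`. -/
def containmentLevel (θ : ℕ) (c : ℕ → Finset ℕ) (n v : ℕ) : ℕ :=
  ((Finset.range (n + 1)).filter fun j => v ∈ hyperedge θ c j).card

/-- The number of vertices contained in exactly `i` hyperedges at age `n`. -/
def levelCount (θ : ℕ) (c : ℕ → Finset ℕ) (n i : ℕ) : ℕ :=
  ((Finset.range (θ + n)).filter fun v => containmentLevel θ c n v = i).card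

/-- The random choices `S n` build a hyperrecursive tree with parameter `θ`: the vertex arriving at
step `n + 1` chooses `θ - 1` of the `θ + n` existing vertices and, given any past
`S 0 = c 0, …, S (n - 1) = c (n - 1)`, all subsets of that size are equally likely. -/
structure IsHyperrecursiveTree {Ω : Type*} [MeasurableSpace Ω] (P : Measure Ω) (θ : ℕ)
    (S : ℕ → Ω → Finset ℕ) : Prop where
  mem : ∀ n ω, S n ω ∈ (Finset.range (θ + n)).powersetCard (θ - 1)
  measurableSet_eq : ∀ n s, MeasurableSet {ω | S n ω = s}
  uniform : ∀ (n : ℕ) (c : ℕ → Finset ℕ), ∀ s ∈ (Finset.range (θ + n)).powersetCard (θ - 1),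
    P.real {ω | (∀ j < n, S j ω = c j) ∧ S n ω = s} =
      P.real {ω | ∀ j < n, S j ω = c j} / ((θ + n).choose (θ - 1) : ℝ)

/-- The covariance matrix at age `n` of the numbers of vertices at the containment levels
`1, …, k` (the index `i : Fin k` stands for the level `i + 1`). -/
def profileCov {Ω : Type*} [MeasurableSpace Ω] (P : Measure Ω) (θ : ℕ)
    (S : ℕ → Ω → Finset ℕ) (k n : ℕ) : Matrix (Fin k) (Fin k) ℝ :=
  Matrix.of fun i j =>
    cov[fun ω => (levelCount θ (fun t => S t ω) n (i + 1) : ℝ),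
      fun ω => (levelCount θ (fun t => S t ω) n (j + 1) : ℝ); P]

/-! ### The associated affine urn

Color `i : Fin (k + 1)` with `i < k` stands for containment level `i + 1`; the last color stands
for all the levels greater than `k`. -/

/-- The replacement vector `(1 - s₁, s₁ - s₂, …, sₖ₋₁ - sₖ, sₖ)` for a sample
`(s₁, …, sₖ₊₁)`. -/
def replacementVector (k : ℕ) (s : Fin (k + 1) → ℝ) : Fin (k + 1) → ℝ := fun j =>
  (if j = 0 then 1 else s (j - 1)) - (if j = Fin.last k then 0 else s j)

/-- The core matrix: its row `i` is the replacement vector for a sample of `θ - 1` balls that are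
all of color `i`. -/
def coreMatrix (θ k : ℕ) : Matrix (Fin (k + 1)) (Fin (k + 1)) ℝ :=
  Matrix.of fun i => replacementVector k (Pi.single i ((θ : ℝ) - 1))

/-- `v` is the principal left eigenvector of the core matrix `A` of a `1`-balanced urn (the leading
eigenvalue is `1`, with right eigenvector the all-ones vector), normalized to have sum `1`. -/
structure IsPrincipalLeftEigenvector {ι : Type*} [Fintype ι] (A : Matrix ι ι ℝ) (v : ι → ℝ) :
    Prop where
  vecMul_eq : Matrix.vecMul v A = v
  sum_eq_one : ∑ i, v i = 1

/-- `P̂ = I - 𝟏ᵀ v`, with `𝟏ᵀ` the all-ones column and `v` a row vector. -/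
def projHat {ι : Type*} [DecidableEq ι] (v : ι → ℝ) : Matrix ι ι ℝ :=
  1 - Matrix.vecMulVec (fun _ => 1) v

/-- `B = s⁻² Aᵀ 𝒬 A` with `𝒬 = s (s - 1) vᵀ v + s diag(v)`. -/
def matrixB {ι : Type*} [Fintype ι] [DecidableEq ι] (A : Matrix ι ι ℝ) (s : ℝ) (v : ι → ℝ) :
    Matrix ι ι ℝ :=
  (s ^ 2)⁻¹ • (A.transpose *
    ((s * (s - 1)) • Matrix.vecMulVec v v + s • Matrix.diagonal v) * A)

/-- The integrand `e^{m Aᵀ} P̂ᵀ B P̂ e^{m A} e^{-m}`. -/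
def sigmaIntegrand {ι : Type*} [Fintype ι] [DecidableEq ι] (A : Matrix ι ι ℝ) (s : ℝ) (v : ι → ℝ)
    (m : ℝ) : Matrix ι ι ℝ :=
  Real.exp (-m) • (NormedSpace.exp (m • A.transpose) * (projHat v).transpose * matrixB A s v *
    projHat v * NormedSpace.exp (m • A))

/-- The limiting matrix `Σ^{(A)}`: the entrywise integral over `(0, ∞)`. -/
def sigmaA {ι : Type*} [Fintype ι] [DecidableEq ι] (A : Matrix ι ι ℝ) (s : ℝ) (v : ι → ℝ) :
    Matrix ι ι ℝ :=
  Matrix.of fun i j => ∫ m in Set.Ioi (0 : ℝ), sigmaIntegrand A s v m i j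

/-- The upper-left `k × k` block of `Σ^{(A)}` for the core matrix `A` and the sample size
`θ - 1`. -/
def sigmaInf (θ k : ℕ) (v : Fin (k + 1) → ℝ) : Matrix (Fin k) (Fin k) ℝ :=
  (sigmaA (coreMatrix θ k) ((θ : ℝ) - 1) v).submatrix Fin.castSucc Fin.castSucc

end HyperrecursiveTree

end

/-! Everything reduces to one triangular recursion, reached from two sides. Put `s = θ - 1` and `t =
n + θ`. Chosen vertices move up one level and the newcomer enters at level one, so the first two
moments of a uniform `s`-sample without replacement give exact recursions for the means and
covariances of the level counts (`levelMean_succ`, `levelCov_succ`). The recursion at a level, or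
pair of levels, involves only itself and lower ones, so each is scalar, of the form `a' = (1 - β /
t) a + b` with `β → α` and `b → c`; then `a / t → c / (1 + α)` (`tendsto_div_of_recursion`). By
induction on levels, means per vertex tend to `levelFreq` and covariances per vertex to `covLimit`,
where `(1 + 2 s) covLimit (i+1) (j+1) = s (covLimit (i+1) j + covLimit i (j+1)) + levelNoise i j`.

On the matrix side the integrand `F` satisfies `F' = Aᵀ F + F A - F`. The projection makes its rows
and columns sum to zero, so the column of ones in `A` contributes nothing, and the entry at levels
`(i+1, j+1)` obeys a scalar equation with damping `1 + 2 s`, driven by the entries at `(i+1, j)` and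
`(i, j+1)`. The initial value is `levelNoise`. Integrating over the half-line yields the recursion
of `covLimit`, together with exponential decay and hence integrability
(`atLevels_sigmaIntegrand_integral`). No spectral analysis of `A` is needed. -/

noncomputable section

namespace HyperrecursiveTree

/-! ### Asymptotics of scalar recursions -/

theorem tendsto_sum_one_div_add_atTop (N : ℕ) :
    Tendsto (fun m : ℕ => ∑ j ∈ Finset.range m, 1 / ((j + N : ℕ) : ℝ)) atTop atTop := by
  refine (not_summable_iff_tendsto_nat_atTop_of_nonneg fun j => by positivity).1 fun h => ?_
  exact Real.not_summable_one_div_natCast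
    ((summable_nat_add_iff (f := fun n : ℕ => 1 / (n : ℝ)) N).1 h)

/-- A nonnegative sequence contracted by the factors `1 - γ / n` tends to zero. -/
theorem tendsto_zero_of_le_one_sub_div_mul {f : ℕ → ℝ} {γ : ℝ} (hγ : 0 < γ) (d : ℕ)
    (hf : ∀ n, 0 ≤ f n) (h : ∀ᶠ n in atTop, f (n + 1) ≤ (1 - γ / ((n + d : ℕ) : ℝ)) * f n) :
    Tendsto f atTop (nhds 0) := by
  obtain ⟨N, hN⟩ := eventually_atTop.1 h
  have key : ∀ m, f (m + N) ≤
      Real.exp (-(γ * ∑ j ∈ Finset.range m, 1 / ((j + (N + d) : ℕ) : ℝ))) * f N := by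
    intro m
    induction m with
    | zero => simp
    | succ m ih =>
      have h1 := hN (m + N) (by omega)
      -- `1 - x ≤ exp (-x)` holds for every `x`, so factors that are negative at early times do no
      -- harm. The product tends to zero because the harmonic series diverges.
      have h2 : 1 - γ / ((m + N + d : ℕ) : ℝ) ≤ Real.exp (-(γ / ((m + N + d : ℕ) : ℝ))) := by
        have := Real.add_one_le_exp (-(γ / ((m + N + d : ℕ) : ℝ)))
        linarith
      have e : m + 1 + N = m + N + 1 := by omega
      rw [e]
      calc f (m + N + 1) ≤ _ := h1
        _ ≤ Real.exp (-(γ / ((m + N + d : ℕ) : ℝ))) * f (m + N) :=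
          mul_le_mul_of_nonneg_right h2 (hf _)
        _ ≤ Real.exp (-(γ / ((m + N + d : ℕ) : ℝ))) *
            (Real.exp (-(γ * ∑ j ∈ Finset.range m, 1 / ((j + (N + d) : ℕ) : ℝ))) * f N) :=
          mul_le_mul_of_nonneg_left ih (Real.exp_pos _).le
        _ = _ := by
          rw [← mul_assoc, ← Real.exp_add, Finset.sum_range_succ, add_assoc m N d]
          congr 2
          ring
  have lim : Tendsto (fun m => Real.exp
      (-(γ * ∑ j ∈ Finset.range m, 1 / ((j + (N + d) : ℕ) : ℝ))) * f N) atTop (nhds (0 * f N)) :=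
    (Real.tendsto_exp_neg_atTop_nhds_zero.comp
      ((tendsto_sum_one_div_add_atTop (N + d)).const_mul_atTop hγ)).mul_const _
  rw [zero_mul] at lim
  exact (tendsto_add_atTop_iff_nat N).1 (squeeze_zero (fun m => hf _) key lim)

theorem tendsto_natCast_add_atTop (d : ℕ) :
    Tendsto (fun n : ℕ => ((n + d : ℕ) : ℝ)) atTop atTop :=
  tendsto_natCast_atTop_atTop.comp (tendsto_add_atTop_nat d)

/-- For fixed `η > 0` the perturbation is eventually below `(b / 2) η`, so the excess of `|e|` over
`η` contracts by `1 - (b / 2) / t` and the preceding lemma applies to its positive part. -/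
theorem tendsto_zero_of_recursion {e β ε : ℕ → ℝ} {b : ℝ} (hb : 0 < b) (d : ℕ)
    (hβ : Tendsto β atTop (nhds b)) (hε : Tendsto ε atTop (nhds 0))
    (h : ∀ᶠ n in atTop, e (n + 1) =
      (1 - β n / ((n + d : ℕ) : ℝ)) * e n + ε n / ((n + d : ℕ) : ℝ)) :
    Tendsto e atTop (nhds 0) := by
  have key : ∀ η > 0, Tendsto (fun n => max (|e n| - η) 0) atTop (nhds 0) := by
    intro η hη
    refine tendsto_zero_of_le_one_sub_div_mul (half_pos hb) d (fun n => le_max_right _ _) ?_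
    have ev1 : ∀ᶠ n in atTop, b / 2 < β n := hβ.eventually_const_lt (half_lt_self hb)
    -- Together with `t > b + 1` this keeps `1 - β / t` nonnegative, so it can be taken out of the
    -- absolute value.
    have ev2 : ∀ᶠ n in atTop, β n < b + 1 := hβ.eventually_lt_const (lt_add_one b)
    have ev3 : ∀ᶠ n in atTop, |ε n| < b / 2 * η :=
      (by simpa using hε.abs : Tendsto (fun n => |ε n|) atTop (nhds 0)).eventually_lt_const
        (by positivity)
    have ev4 := (tendsto_natCast_add_atTop d).eventually_gt_atTop (b + 1)
    filter_upwards [h, ev1, ev2, ev3, ev4] with n h0 h1 h2 h3 h4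
    set t : ℝ := ((n + d : ℕ) : ℝ)
    have ht : 0 < t := by linarith
    have c1 : 0 ≤ 1 - β n / t := by
      rw [sub_nonneg, div_le_one ht]; linarith
    have c2 : 1 - β n / t ≤ 1 - b / 2 / t := by
      gcongr
    have c3 : |e (n + 1)| ≤ (1 - b / 2 / t) * |e n| + b / 2 * η / t := by
      rw [h0]
      refine (abs_add_le _ _).trans (add_le_add ?_ ?_)
      · rw [abs_mul, abs_of_nonneg c1]
        exact mul_le_mul_of_nonneg_right c2 (abs_nonneg _)
      · rw [abs_div, abs_of_pos ht]
        gcongr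
    refine max_le ?_ (mul_nonneg (c1.trans c2) (le_max_right _ _))
    calc |e (n + 1)| - η ≤ (1 - b / 2 / t) * (|e n| - η) := by
          have : (1 - b / 2 / t) * (|e n| - η) =
            (1 - b / 2 / t) * |e n| + b / 2 * η / t - η := by ring
          linarith
      _ ≤ _ := mul_le_mul_of_nonneg_left (le_max_left _ _) (c1.trans c2)
  rw [Metric.tendsto_nhds]
  intro η hη
  have := (key (η / 2) (half_pos hη)).eventually_lt_const (half_pos hη)
  filter_upwards [this] with n hn
  rw [Real.dist_eq, sub_zero]
  have := (le_max_left (|e n| - η / 2) 0).trans_lt hn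
  linarith

/-- The growth rate of a sequence with `a' = (1 - β / t) a + b` at time `t`. -/
theorem tendsto_div_of_recursion {a β b : ℕ → ℝ} {α c : ℝ} (hα : 0 ≤ α) (d : ℕ) (hd : 0 < d)
    (hβ : Tendsto β atTop (nhds α)) (hb : Tendsto b atTop (nhds c))
    (h : ∀ n, a (n + 1) = (1 - β n / ((n + d : ℕ) : ℝ)) * a n + b n) :
    Tendsto (fun n => a n / ((n + d : ℕ) : ℝ)) atTop (nhds (c / (1 + α))) := by
  have h1 : Tendsto (fun n => a n / ((n + d : ℕ) : ℝ) - c / (1 + α)) atTop (nhds 0) := by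
    -- Dividing by the new time gives `(1 - β / t) · t / (t + 1) = 1 - (1 + β) / (t + 1)`: hence the
    -- damping `1 + β` and the shift `d + 1`.
    refine tendsto_zero_of_recursion (β := fun n => 1 + β n)
      (ε := fun n => b n - (1 + β n) * (c / (1 + α))) (b := 1 + α) (by linarith) (d + 1)
      (hβ.const_add 1) ?_ (Eventually.of_forall fun n => ?_)
    · have := hb.sub ((hβ.const_add 1).mul_const (c / (1 + α)))
      rwa [mul_div_cancel₀ _ (by linarith : 1 + α ≠ 0), sub_self] at this
    · have ht : (0 : ℝ) < (n : ℝ) + d := by positivity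
      rw [h n]
      push_cast
      have e : (n : ℝ) + 1 + d = n + (d + 1) := by ring
      rw [e]
      have ht' : (n : ℝ) + (d + 1) ≠ 0 := by positivity
      have : 1 + α ≠ 0 := by linarith
      field_simp
      ring
  simpa using h1.add_const (c / (1 + α))

/-! ### Moments of uniform samples without replacement -/

theorem card_filter_mem_powersetCard {T : Finset ℕ} {r v : ℕ} (hr : 1 ≤ r) (hv : v ∈ T) :
    (((T.powersetCard r).filter (v ∈ ·)).card : ℝ) =
      (r : ℝ) / T.card * (T.card.choose r : ℝ) := by
  have h := Finset.card_filter_powersetCard_subset {v} T r (by simpa using hv) (by simpa using hr)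
  simp only [Finset.singleton_subset_iff, Finset.card_singleton] at h
  rw [h]
  have hT : 0 < T.card := Finset.card_pos.2 ⟨v, hv⟩
  obtain ⟨t, ht⟩ : ∃ t, T.card = t + 1 := ⟨T.card - 1, by omega⟩
  obtain ⟨q, rfl⟩ : ∃ q, r = q + 1 := ⟨r - 1, by omega⟩
  rw [ht]
  have := Nat.add_one_mul_choose_eq t q
  have h2 : ((t : ℝ) + 1) * (t.choose q : ℝ) = ((t + 1).choose (q + 1) : ℝ) * (q + 1) := by
    exact_mod_cast this
  simp only [Nat.add_sub_cancel]
  push_cast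
  field_simp
  linarith

theorem card_filter_mem_mem_powersetCard {T : Finset ℕ} {r v w : ℕ} (hr : 1 ≤ r) (hv : v ∈ T)
    (hw : w ∈ T) (hvw : v ≠ w) :
    (((T.powersetCard r).filter fun s => v ∈ s ∧ w ∈ s).card : ℝ) =
      (r : ℝ) * (r - 1) / (T.card * (T.card - 1)) * (T.card.choose r : ℝ) := by
  have hsub : ({v, w} : Finset ℕ) ⊆ T := by
    intro x hx
    rcases Finset.mem_insert.1 hx with rfl | hx
    · exact hv
    · rwa [Finset.mem_singleton.1 hx]
  have hc : ({v, w} : Finset ℕ).card = 2 := Finset.card_pair hvw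
  rcases Nat.lt_or_ge r 2 with h2 | h2
  -- Samples of size one (`θ = 2`) contain no pair, in agreement with the factor `r - 1`.
  · obtain rfl : r = 1 := by omega
    have : ((T.powersetCard 1).filter fun s => v ∈ s ∧ w ∈ s) = ∅ := by
      refine Finset.filter_eq_empty_iff.2 fun s hs hvs => ?_
      have h1 := (Finset.mem_powersetCard.1 hs).2
      have : ({v, w} : Finset ℕ) ⊆ s := by
        intro x hx
        rcases Finset.mem_insert.1 hx with rfl | hx
        · exact hvs.1
        · rw [Finset.mem_singleton.1 hx]; exact hvs.2
      have := Finset.card_le_card this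
      omega
    rw [this]
    simp
  · have h := Finset.card_filter_powersetCard_subset {v, w} T r hsub (by omega)
    simp only [Finset.insert_subset_iff, Finset.singleton_subset_iff, hc] at h
    rw [h]
    have hT : 2 ≤ T.card := hc ▸ Finset.card_le_card hsub
    obtain ⟨t, ht⟩ : ∃ t, T.card = t + 2 := ⟨T.card - 2, by omega⟩
    obtain ⟨q, rfl⟩ : ∃ q, r = q + 2 := ⟨r - 2, by omega⟩
    rw [ht]
    have e1 := Nat.add_one_mul_choose_eq t q
    have e2 := Nat.add_one_mul_choose_eq (t + 1) (q + 1)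
    have h1 : ((t : ℝ) + 1) * (t.choose q : ℝ) = ((t + 1).choose (q + 1) : ℝ) * (q + 1) := by
      exact_mod_cast e1
    have h2 : ((t : ℝ) + 2) * ((t + 1).choose (q + 1) : ℝ) =
        ((t + 2).choose (q + 2) : ℝ) * (q + 2) := by
      have : ((t : ℝ) + 1 + 1) * ((t + 1).choose (q + 1) : ℝ) =
        ((t + 2).choose (q + 2) : ℝ) * (q + 1 + 1) := by exact_mod_cast e2
      linarith
    simp only [Nat.add_sub_cancel]
    push_cast
    have p1 : (t : ℝ) + 2 - 1 ≠ 0 := by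
      have : (0 : ℝ) ≤ t := t.cast_nonneg
      linarith
    rw [div_mul_eq_mul_div, eq_div_iff (mul_ne_zero (by positivity) p1)]
    linear_combination ((t : ℝ) + 2) * h1 + ((q : ℝ) + 1) * h2

theorem natCast_card_inter_eq_sum (V s : Finset ℕ) :
    (((s ∩ V).card : ℕ) : ℝ) = ∑ v ∈ V, if v ∈ s then 1 else 0 := by
  rw [Finset.inter_comm, ← Finset.filter_mem_eq_inter, Finset.card_filter]
  push_cast
  rfl

/-- The mean number of elements of `V` in a uniform sample. -/
theorem sum_card_inter_powersetCard {T V : Finset ℕ} {r : ℕ} (hr : 1 ≤ r) (hV : V ⊆ T) :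
    ∑ s ∈ T.powersetCard r, ((s ∩ V).card : ℝ) =
      (T.card.choose r : ℝ) * ((r : ℝ) / T.card * V.card) := by
  simp_rw [natCast_card_inter_eq_sum V]
  rw [Finset.sum_comm]
  have : ∀ v ∈ V, (∑ s ∈ T.powersetCard r, if v ∈ s then (1 : ℝ) else 0) =
      (r : ℝ) / T.card * (T.card.choose r : ℝ) := fun v hv => by
    rw [← card_filter_mem_powersetCard hr (hV hv), Finset.card_filter]
    push_cast
    rfl
  rw [Finset.sum_congr rfl this, Finset.sum_const, nsmul_eq_mul]
  ring

/-- The mixed second moment of the numbers of elements of `V` and of `W` in a uniform sample. -/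
theorem sum_card_inter_mul_card_inter_powersetCard {T V W : Finset ℕ} {r : ℕ} (hr : 1 ≤ r)
    (hV : V ⊆ T) (hW : W ⊆ T) :
    ∑ s ∈ T.powersetCard r, ((s ∩ V).card : ℝ) * ((s ∩ W).card : ℝ) =
      (T.card.choose r : ℝ) * ((r : ℝ) * (r - 1) / (T.card * (T.card - 1)) *
        ((V.card : ℝ) * W.card - (V ∩ W).card) + (r : ℝ) / T.card * (V ∩ W).card) := by
  -- `V ∩ W` also has the shape `s ∩ W`; naming its cardinality protects it from the rewriting
  -- below.
  generalize hK : ((V ∩ W).card : ℝ) = K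
  simp_rw [natCast_card_inter_eq_sum V, natCast_card_inter_eq_sum W,
    Finset.sum_mul_sum]
  rw [Finset.sum_comm]
  simp_rw [Finset.sum_comm (s := T.powersetCard r)]
  set p2 : ℝ := (r : ℝ) * (r - 1) / (T.card * (T.card - 1))
  set p1 : ℝ := (r : ℝ) / T.card
  set N : ℝ := (T.card.choose r : ℝ)
  -- Distinct vertices are sampled together with probability `p2`, a single one with probability
  -- `p1`; the diagonal is a correction by `p1 - p2`.
  have : ∀ v ∈ V, ∀ w ∈ W, (∑ s ∈ T.powersetCard r,
      (if v ∈ s then (1 : ℝ) else 0) * (if w ∈ s then (1 : ℝ) else 0)) =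
      p2 * N + if v = w then (p1 - p2) * N else 0 := fun v hv w hw => by
    have h : ∀ s : Finset ℕ, (if v ∈ s then (1 : ℝ) else 0) * (if w ∈ s then (1 : ℝ) else 0) =
        ((if v ∈ s ∧ w ∈ s then 1 else 0 : ℕ) : ℝ) := fun s => by
      by_cases h1 : v ∈ s <;> by_cases h2 : w ∈ s <;> simp [h1, h2]
    simp_rw [h]
    rw [← Nat.cast_sum, ← Finset.card_filter]
    by_cases hvw : v = w
    · subst hvw
      simp only [and_self, if_true]
      rw [card_filter_mem_powersetCard hr (hV hv)]
      ring
    · rw [card_filter_mem_mem_powersetCard hr (hV hv) (hW hw) hvw, if_neg hvw, add_zero]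
  rw [Finset.sum_congr rfl fun v hv => Finset.sum_congr rfl (this v hv)]
  simp_rw [Finset.sum_add_distrib, Finset.sum_const, nsmul_eq_mul, Finset.sum_ite_eq]
  rw [← Finset.sum_filter, Finset.sum_const, nsmul_eq_mul, Finset.filter_mem_eq_inter, hK]
  ring

section

/-! ### Evolution of the containment levels -/

/-- The set of vertices at containment level `i` at age `n`. -/
def levelSet (θ : ℕ) (c : ℕ → Finset ℕ) (n i : ℕ) : Finset ℕ :=
  (Finset.range (θ + n)).filter fun v => containmentLevel θ c n v = i

theorem card_levelSet (θ : ℕ) (c : ℕ → Finset ℕ) (n i : ℕ) :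
    (levelSet θ c n i).card = levelCount θ c n i := rfl

theorem levelSet_subset (θ : ℕ) (c : ℕ → Finset ℕ) (n i : ℕ) :
    levelSet θ c n i ⊆ Finset.range (θ + n) := Finset.filter_subset _ _

theorem levelSet_inter_levelSet (θ : ℕ) (c : ℕ → Finset ℕ) (n i j : ℕ) :
    levelSet θ c n i ∩ levelSet θ c n j = if i = j then levelSet θ c n i else ∅ := by
  split_ifs with h
  · rw [h, Finset.inter_self]
  · ext v
    simp only [levelSet, Finset.mem_inter, Finset.mem_filter, Finset.notMem_empty, iff_false]
    rintro ⟨⟨_, h1⟩, _, h2⟩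
    exact h (h1.symm.trans h2)

theorem containmentLevel_congr {θ : ℕ} {c c' : ℕ → Finset ℕ} {n : ℕ}
    (h : ∀ j < n, c j = c' j) (v : ℕ) : containmentLevel θ c n v = containmentLevel θ c' n v := by
  unfold containmentLevel
  congr 1
  refine Finset.filter_congr fun j hj => ?_
  cases j with
  | zero => rfl
  | succ j => simp only [hyperedge, h j (by simpa using hj)]

theorem levelSet_congr {θ : ℕ} {c c' : ℕ → Finset ℕ} {n : ℕ}
    (h : ∀ j < n, c j = c' j) (i : ℕ) : levelSet θ c n i = levelSet θ c' n i := by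
  unfold levelSet
  simp only [containmentLevel_congr h]

theorem levelCount_congr {θ : ℕ} {c c' : ℕ → Finset ℕ} {n : ℕ}
    (h : ∀ j < n, c j = c' j) (i : ℕ) : levelCount θ c n i = levelCount θ c' n i :=
  congrArg Finset.card (levelSet_congr h i)

theorem containmentLevel_succ (θ : ℕ) (c : ℕ → Finset ℕ) (n v : ℕ) :
    containmentLevel θ c (n + 1) v =
      containmentLevel θ c n v + if v ∈ insert (θ + n) (c n) then 1 else 0 := by
  unfold containmentLevel
  rw [Finset.range_add_one (n := n + 1), Finset.filter_insert]
  split_ifs with h1 h2 h2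
  · rw [Finset.card_insert_of_notMem (by simp)]
  · exact absurd h1 h2
  · exact absurd h2 h1
  · rfl

/-- Every existing vertex lies in the hyperedge of its arrival, or in `e₀`. This is the zero
boundary value of all the recursions. -/
theorem levelCount_zero (θ : ℕ) (c : ℕ → Finset ℕ) (n : ℕ) : levelCount θ c n 0 = 0 := by
  unfold levelCount containmentLevel
  refine Finset.card_eq_zero.2 (Finset.filter_eq_empty_iff.2 fun v hv h => ?_)
  have hv := Finset.mem_range.1 hv
  rw [Finset.card_eq_zero, Finset.filter_eq_empty_iff] at h
  rcases Nat.lt_or_ge v θ with h1 | h1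
  · exact h (Finset.mem_range.2 (Nat.succ_pos n)) (Finset.mem_range.2 h1)
  · refine h (x := v - θ + 1) (Finset.mem_range.2 (by omega)) ?_
    rw [hyperedge, Nat.add_sub_cancel' h1]
    exact Finset.mem_insert_self _ _

theorem containmentLevel_eq_zero {θ : ℕ} {c : ℕ → Finset ℕ}
    (hc : ∀ j, c j ⊆ Finset.range (θ + j)) (n : ℕ) : containmentLevel θ c n (θ + n) = 0 := by
  unfold containmentLevel
  refine Finset.card_eq_zero.2 (Finset.filter_eq_empty_iff.2 fun j hj h => ?_)
  have hj := Finset.mem_range.1 hj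
  cases j with
  | zero => simp [hyperedge] at h
  | succ j =>
    rcases Finset.mem_insert.1 h with h | h
    · omega
    · have := Finset.mem_range.1 (hc j h)
      omega

/-- Chosen vertices of level `i` enter level `i + 1` and those of level `i + 1` leave it. The
newcomer had level `0` before its own hyperedge, so it lands in level one: the indicator of `i = 0`.
-/
theorem levelCount_succ {θ : ℕ} {c : ℕ → Finset ℕ}
    (hc : ∀ j, c j ⊆ Finset.range (θ + j)) (n i : ℕ) :
    (levelCount θ c (n + 1) (i + 1) : ℝ) =
      (levelCount θ c n (i + 1) : ℝ) + (if i = 0 then 1 else 0) +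
        ((c n ∩ levelSet θ c n i).card : ℝ) - ((c n ∩ levelSet θ c n (i + 1)).card : ℝ) := by
  have hinter : ∀ l, ((c n ∩ levelSet θ c n l).card : ℝ) = ∑ v ∈ Finset.range (θ + n),
      if v ∈ c n ∧ containmentLevel θ c n v = l then (1 : ℝ) else 0 := fun l => by
    have : c n ∩ levelSet θ c n l = (Finset.range (θ + n)).filter
        fun v => v ∈ c n ∧ containmentLevel θ c n v = l := by
      ext v
      simp only [levelSet, Finset.mem_inter, Finset.mem_filter]
      tauto
    rw [this, Finset.card_filter]
    push_cast
    rfl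
  have hcount : ∀ m l, (levelCount θ c m l : ℝ) = ∑ v ∈ Finset.range (θ + m),
      if containmentLevel θ c m v = l then (1 : ℝ) else 0 := fun m l => by
    rw [levelCount, Finset.card_filter]
    push_cast
    rfl
  rw [hinter, hinter, hcount, hcount, ← add_assoc, Finset.sum_range_succ,
    containmentLevel_succ, containmentLevel_eq_zero hc, if_pos (Finset.mem_insert_self _ _),
    show (if 0 + 1 = i + 1 then (1 : ℝ) else 0) = if i = 0 then 1 else 0 by
      by_cases h : i = 0 <;> simp [h]]
  have : ∀ v ∈ Finset.range (θ + n),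
      (if containmentLevel θ c (n + 1) v = i + 1 then (1 : ℝ) else 0) =
      (if containmentLevel θ c n v = i + 1 then (1 : ℝ) else 0) +
      (if v ∈ c n ∧ containmentLevel θ c n v = i then (1 : ℝ) else 0) -
      (if v ∈ c n ∧ containmentLevel θ c n v = i + 1 then (1 : ℝ) else 0) := fun v hv => by
    have hne : v ≠ θ + n := (Finset.mem_range.1 hv).ne
    rw [containmentLevel_succ]
    simp only [Finset.mem_insert, hne, false_or]
    by_cases h : v ∈ c n <;> simp [h]
  rw [Finset.sum_congr rfl this, Finset.sum_sub_distrib, Finset.sum_add_distrib]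
  ring

/-! ### Expectations over the choices -/

/-- The past choices `c` of the first `n` steps, continued by `∅`. -/
def extendPast {n : ℕ} (c : Fin n → Finset ℕ) (j : ℕ) : Finset ℕ :=
  if h : j < n then c ⟨j, h⟩ else ∅

/-- The possible choices at the first `n` steps. -/
def pasts (θ n : ℕ) : Finset (Fin n → Finset ℕ) :=
  Fintype.piFinset fun j : Fin n => (Finset.range (θ + j)).powersetCard (θ - 1)

-- Only finitely many pasts are possible, so a function of the past is a finite combination of
-- indicators of cylinder events. Integrability and conditioning thereby become finite sums.
open Classical in
theorem eq_sum_pasts {θ n : ℕ} {c : ℕ → Finset ℕ}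
    (hc : ∀ j, c j ∈ (Finset.range (θ + j)).powersetCard (θ - 1))
    {f : (ℕ → Finset ℕ) → ℝ} (hf : ∀ c c', (∀ j < n, c j = c' j) → f c = f c') :
    f c = ∑ p ∈ pasts θ n, if ∀ j < n, c j = extendPast p j then f (extendPast p) else 0 := by
  rw [Finset.sum_eq_single fun j : Fin n => c j]
  · have : ∀ j < n, c j = extendPast (fun j : Fin n => c j) j := fun j hj => by
      simp [extendPast, hj]
    rw [if_pos this]
    exact hf _ _ this
  · intro p _ hp
    refine if_neg fun h => hp (funext fun j => ?_)
    rw [h j j.2]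
    simp [extendPast]
  · intro h
    exact absurd (Fintype.mem_piFinset.2 fun j : Fin n => hc j) h

variable {Ω : Type*} [MeasurableSpace Ω] {P : Measure Ω} {θ : ℕ} {S : ℕ → Ω → Finset ℕ}

theorem IsHyperrecursiveTree.measurableSet_past (hS : IsHyperrecursiveTree P θ S) (n : ℕ)
    (c : ℕ → Finset ℕ) : MeasurableSet {ω | ∀ j < n, S j ω = c j} := by
  have : {ω | ∀ j < n, S j ω = c j} = ⋂ j ∈ Set.Iio n, {ω | S j ω = c j} := by
    ext ω
    simp
  rw [this]
  exact MeasurableSet.biInter (Set.to_countable _) fun j _ => hS.measurableSet_eq j _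

theorem integral_ite_const [IsProbabilityMeasure P] {p : Ω → Prop} [DecidablePred p]
    (hp : MeasurableSet {ω | p ω}) (a : ℝ) :
    Integrable (fun ω => if p ω then a else 0) P ∧
      ∫ ω, (if p ω then a else 0) ∂P = P.real {ω | p ω} * a := by
  have : (fun ω => if p ω then a else 0) = {ω | p ω}.indicator fun _ => a := by
    ext ω
    simp [Set.indicator_apply]
  rw [this]
  refine ⟨(integrable_const a).indicator hp, ?_⟩
  rw [integral_indicator_const a hp, smul_eq_mul]

theorem IsHyperrecursiveTree.integrable_past [IsProbabilityMeasure P]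
    (hS : IsHyperrecursiveTree P θ S) {n : ℕ} {f : (ℕ → Finset ℕ) → ℝ}
    (hf : ∀ c c', (∀ j < n, c j = c' j) → f c = f c') :
    Integrable (fun ω => f fun t => S t ω) P := by
  classical
  rw [funext fun ω => eq_sum_pasts (fun j => hS.mem j ω) hf]
  exact integrable_finsetSum _ fun p _ =>
    (integral_ite_const (hS.measurableSet_past n (extendPast p)) _).1

/-- The choice at step `n + 1` can be averaged out, given the past. -/
theorem IsHyperrecursiveTree.integral_step [IsProbabilityMeasure P]
    (hS : IsHyperrecursiveTree P θ S) {n : ℕ} {f : (ℕ → Finset ℕ) → Finset ℕ → ℝ}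
    (hf : ∀ c c', (∀ j < n, c j = c' j) → f c = f c') {g : (ℕ → Finset ℕ) → ℝ}
    (hg : ∀ c, ∑ s ∈ (Finset.range (θ + n)).powersetCard (θ - 1), f c s =
      ((θ + n).choose (θ - 1) : ℝ) * g c) :
    ∫ ω, f (fun t => S t ω) (S n ω) ∂P = ∫ ω, g (fun t => S t ω) ∂P := by
  classical
  have hN : ((θ + n).choose (θ - 1) : ℝ) ≠ 0 :=
    Nat.cast_ne_zero.2 (Nat.choose_pos (by omega)).ne'
  -- The average over samples inherits from `f` that it depends on the past alone; the number of
  -- samples is cancelled.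
  have hg' : ∀ c c', (∀ j < n, c j = c' j) → g c = g c' := fun c c' h => by
    have h1 := hg c
    rw [hf c c' h, hg c'] at h1
    exact (mul_left_cancel₀ hN h1).symm
  have hm : ∀ (p : Fin n → Finset ℕ) (s : Finset ℕ),
      MeasurableSet {ω | (∀ j < n, S j ω = extendPast p j) ∧ S n ω = s} := fun p s =>
    (hS.measurableSet_past n (extendPast p)).inter (hS.measurableSet_eq n s)
  have h1 : ∀ ω, f (fun t => S t ω) (S n ω) =
      ∑ p ∈ pasts θ n, ∑ s ∈ (Finset.range (θ + n)).powersetCard (θ - 1),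
        if (∀ j < n, S j ω = extendPast p j) ∧ S n ω = s then f (extendPast p) s else 0 := by
    intro ω
    rw [eq_sum_pasts (n := n) (f := fun c => f c (S n ω)) (fun j => hS.mem j ω)
      fun c c' h => by rw [hf c c' h]]
    refine Finset.sum_congr rfl fun p _ => ?_
    by_cases h : ∀ j < n, S j ω = extendPast p j
    · rw [if_pos h, Finset.sum_congr rfl fun s _ => if_congr (and_iff_right h) rfl rfl,
        Finset.sum_ite_eq, if_pos (hS.mem n ω)]
    · rw [if_neg h, Finset.sum_congr rfl fun s _ => if_neg fun h' => h h'.1,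
        Finset.sum_const_zero]
  simp_rw [h1]
  rw [integral_finsetSum _ fun p _ => integrable_finsetSum _ fun s _ =>
    (integral_ite_const (hm p s) _).1]
  conv_rhs =>
    enter [2, ω]
    rw [eq_sum_pasts (fun j => hS.mem j ω) hg']
  rw [integral_finsetSum _ fun p _ =>
    (integral_ite_const (hS.measurableSet_past n (extendPast p)) _).1]
  refine Finset.sum_congr rfl fun p _ => ?_
  rw [integral_finsetSum _ fun s _ => (integral_ite_const (hm p s) _).1,
    (integral_ite_const (hS.measurableSet_past n (extendPast p)) _).2]
  have h2 : ∀ s ∈ (Finset.range (θ + n)).powersetCard (θ - 1),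
      ∫ ω, (if (∀ j < n, S j ω = extendPast p j) ∧ S n ω = s then f (extendPast p) s else 0) ∂P =
      P.real {ω | ∀ j < n, S j ω = extendPast p j} / ((θ + n).choose (θ - 1) : ℝ) *
        f (extendPast p) s := fun s hs => by
    rw [(integral_ite_const (hm p s) _).2, hS.uniform n (extendPast p) s hs]
  rw [Finset.sum_congr rfl h2, ← Finset.mul_sum, hg]
  field_simp

end

section

/-! ### The recursions for means and covariances -/

/-- The combination `d i j - d i (j + 1) - d (i + 1) j + d (i + 1) (j + 1)` of the entries of the
diagonal matrix `d` with diagonal `x`. -/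
def diagDiff (x : ℕ → ℝ) (i j : ℕ) : ℝ :=
  (if i = j then x i else 0) - (if i = j + 1 then x i else 0) -
    (if i + 1 = j then x (i + 1) else 0) + (if i + 1 = j + 1 then x (i + 1) else 0)

/-- The function `f` is integrable with integral `m`. -/
def HasMean {Ω : Type*} [MeasurableSpace Ω] (P : Measure Ω) (f : Ω → ℝ) (m : ℝ) : Prop :=
  Integrable f P ∧ ∫ ω, f ω ∂P = m

namespace HasMean

variable {Ω : Type*} [MeasurableSpace Ω] {P : Measure Ω} {f g : Ω → ℝ} {a b : ℝ}

theorem add (hf : HasMean P f a) (hg : HasMean P g b) : HasMean P (fun ω => f ω + g ω) (a + b) :=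
  ⟨hf.1.add hg.1, by rw [integral_add hf.1 hg.1, hf.2, hg.2]⟩

theorem sub (hf : HasMean P f a) (hg : HasMean P g b) : HasMean P (fun ω => f ω - g ω) (a - b) :=
  ⟨hf.1.sub hg.1, by rw [integral_sub hf.1 hg.1, hf.2, hg.2]⟩

theorem const_mul (c : ℝ) (hf : HasMean P f a) : HasMean P (fun ω => c * f ω) (c * a) :=
  ⟨hf.1.const_mul c, by rw [integral_const_mul, hf.2]⟩

theorem const [IsProbabilityMeasure P] (c : ℝ) : HasMean P (fun _ => c) c :=
  ⟨integrable_const c, by simp⟩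

theorem ite_zero (p : Prop) [Decidable p] (hf : HasMean P f a) :
    HasMean P (fun ω => if p then f ω else 0) (if p then a else 0) := by
  split_ifs
  · exact hf
  · exact ⟨integrable_zero _ _ _, by simp⟩

end HasMean

theorem sum_powersetCard_affine {T V W : Finset ℕ} {r : ℕ} (hr : 1 ≤ r) (hV : V ⊆ T) (hW : W ⊆ T)
    (a : ℝ) :
    ∑ s ∈ T.powersetCard r, (a + ((s ∩ V).card : ℝ) - ((s ∩ W).card : ℝ)) =
      (T.card.choose r : ℝ) * (a + (r : ℝ) / T.card * (V.card - W.card)) := by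
  rw [Finset.sum_sub_distrib, Finset.sum_add_distrib, sum_card_inter_powersetCard hr hV,
    sum_card_inter_powersetCard hr hW, Finset.sum_const, Finset.card_powersetCard, nsmul_eq_mul]
  ring

theorem sum_powersetCard_affine_mul_affine {T V W V' W' : Finset ℕ} {r : ℕ} (hr : 1 ≤ r)
    (hV : V ⊆ T) (hW : W ⊆ T) (hV' : V' ⊆ T) (hW' : W' ⊆ T) (a b : ℝ) :
    ∑ s ∈ T.powersetCard r, (a + ((s ∩ V).card : ℝ) - ((s ∩ W).card : ℝ)) *
        (b + ((s ∩ V').card : ℝ) - ((s ∩ W').card : ℝ)) =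
      (T.card.choose r : ℝ) * (a * b + (r : ℝ) / T.card * (a * (V'.card - W'.card) +
        b * (V.card - W.card)) + (r : ℝ) * (r - 1) / (T.card * (T.card - 1)) *
        ((V.card - W.card) * (V'.card - W'.card)) +
        ((r : ℝ) / T.card - (r : ℝ) * (r - 1) / (T.card * (T.card - 1))) *
        ((V ∩ V').card - (V ∩ W').card - (W ∩ V').card + (W ∩ W').card)) := by
  have : ∀ s : Finset ℕ, (a + ((s ∩ V).card : ℝ) - ((s ∩ W).card : ℝ)) *
      (b + ((s ∩ V').card : ℝ) - ((s ∩ W').card : ℝ)) =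
      a * (b + ((s ∩ V').card : ℝ) - ((s ∩ W').card : ℝ)) +
      b * (0 + ((s ∩ V).card : ℝ) - ((s ∩ W).card : ℝ)) +
      ((s ∩ V).card : ℝ) * ((s ∩ V').card : ℝ) - ((s ∩ V).card : ℝ) * ((s ∩ W').card : ℝ) -
      ((s ∩ W).card : ℝ) * ((s ∩ V').card : ℝ) + ((s ∩ W).card : ℝ) * ((s ∩ W').card : ℝ) :=
    fun s => by ring
  simp_rw [this]
  rw [Finset.sum_add_distrib, Finset.sum_sub_distrib, Finset.sum_sub_distrib,
    Finset.sum_add_distrib, Finset.sum_add_distrib, ← Finset.mul_sum, ← Finset.mul_sum,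
    sum_powersetCard_affine hr hV' hW', sum_powersetCard_affine hr hV hW,
    sum_card_inter_mul_card_inter_powersetCard hr hV hV',
    sum_card_inter_mul_card_inter_powersetCard hr hV hW',
    sum_card_inter_mul_card_inter_powersetCard hr hW hV',
    sum_card_inter_mul_card_inter_powersetCard hr hW hW']
  ring

/-- The mean number of vertices at containment level `i` at age `n`. -/
def levelMean {Ω : Type*} [MeasurableSpace Ω] (P : Measure Ω) (θ : ℕ) (S : ℕ → Ω → Finset ℕ)
    (n i : ℕ) : ℝ :=
  ∫ ω, (levelCount θ (fun t => S t ω) n i : ℝ) ∂P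

/-- The covariance of the numbers of vertices at containment levels `i` and `j` at age `n`. -/
def levelCov {Ω : Type*} [MeasurableSpace Ω] (P : Measure Ω) (θ : ℕ) (S : ℕ → Ω → Finset ℕ)
    (n i j : ℕ) : ℝ :=
  cov[fun ω => (levelCount θ (fun t => S t ω) n i : ℝ),
    fun ω => (levelCount θ (fun t => S t ω) n j : ℝ); P]

/-- The probability that a uniform `s`-sample from `t` vertices contains a given vertex. -/
def inclusionProb (s t : ℝ) : ℝ := s / t

/-- The probability that a uniform `s`-sample from `t` vertices contains two given vertices. -/
def pairProb (s t : ℝ) : ℝ := s * (s - 1) / (t * (t - 1))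

variable {Ω : Type*} [MeasurableSpace Ω] {P : Measure Ω} {θ : ℕ} {S : ℕ → Ω → Finset ℕ}

namespace IsHyperrecursiveTree

theorem subset_range (hS : IsHyperrecursiveTree P θ S) (ω : Ω) (j : ℕ) :
    S j ω ⊆ Finset.range (θ + j) := (Finset.mem_powersetCard.1 (hS.mem j ω)).1

variable [IsProbabilityMeasure P]

theorem hasMean_levelCount (hS : IsHyperrecursiveTree P θ S) (n i : ℕ) :
    HasMean P (fun ω => (levelCount θ (fun t => S t ω) n i : ℝ)) (levelMean P θ S n i) :=
  ⟨hS.integrable_past (n := n) (f := fun c => (levelCount θ c n i : ℝ))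
    fun c c' h => by rw [levelCount_congr h], rfl⟩

theorem integrable_levelCount_mul (hS : IsHyperrecursiveTree P θ S) (n i j : ℕ) :
    Integrable (fun ω => (levelCount θ (fun t => S t ω) n i : ℝ) *
      (levelCount θ (fun t => S t ω) n j : ℝ)) P :=
  hS.integrable_past (n := n) (f := fun c => (levelCount θ c n i : ℝ) * (levelCount θ c n j : ℝ))
    fun c c' h => by rw [levelCount_congr h, levelCount_congr h]

theorem memLp_levelCount (hS : IsHyperrecursiveTree P θ S) (n i : ℕ) :
    MemLp (fun ω => (levelCount θ (fun t => S t ω) n i : ℝ)) 2 P := by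
  rw [memLp_two_iff_integrable_sq (hS.hasMean_levelCount n i).1.1]
  simp_rw [sq]
  exact hS.integrable_levelCount_mul n i i

theorem hasMean_levelCount_mul (hS : IsHyperrecursiveTree P θ S) (n i j : ℕ) :
    HasMean P (fun ω => (levelCount θ (fun t => S t ω) n i : ℝ) *
      (levelCount θ (fun t => S t ω) n j : ℝ))
      (levelCov P θ S n i j + levelMean P θ S n i * levelMean P θ S n j) := by
  refine ⟨hS.integrable_levelCount_mul n i j, ?_⟩
  rw [levelCov, covariance_eq_sub (hS.memLp_levelCount n i) (hS.memLp_levelCount n j)]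
  simp only [levelMean, Pi.mul_apply]
  ring

theorem levelMean_succ (hS : IsHyperrecursiveTree P θ S) (hθ : 2 ≤ θ) (n i : ℕ) :
    levelMean P θ S (n + 1) (i + 1) = levelMean P θ S n (i + 1) + (if i = 0 then 1 else 0) +
      inclusionProb ((θ : ℝ) - 1) ((n + θ : ℕ) : ℝ) *
        (levelMean P θ S n i - levelMean P θ S n (i + 1)) := by
  have hr : (((θ - 1 : ℕ) : ℕ) : ℝ) = (θ : ℝ) - 1 := by
    rw [Nat.cast_sub (by omega), Nat.cast_one]
  rw [levelMean]
  simp_rw [fun ω => levelCount_succ (c := fun t => S t ω) (hS.subset_range ω) n i]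
  rw [hS.integral_step (n := n)
    (f := fun c s => (levelCount θ c n (i + 1) : ℝ) + (if i = 0 then 1 else 0) +
      ((s ∩ levelSet θ c n i).card : ℝ) - ((s ∩ levelSet θ c n (i + 1)).card : ℝ))
    (g := fun c => (levelCount θ c n (i + 1) : ℝ) + (if i = 0 then 1 else 0) +
      inclusionProb ((θ : ℝ) - 1) ((n + θ : ℕ) : ℝ) *
        ((levelCount θ c n i : ℝ) - (levelCount θ c n (i + 1) : ℝ)))]
  · exact (((hS.hasMean_levelCount n (i + 1)).add (HasMean.const _)).add
      (((hS.hasMean_levelCount n i).sub (hS.hasMean_levelCount n (i + 1))).const_mul _)).2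
  · intro c c' h
    rw [levelCount_congr h, levelSet_congr h, levelSet_congr h]
  · intro c
    rw [sum_powersetCard_affine (by omega) (levelSet_subset ..) (levelSet_subset ..),
      Finset.card_range, hr, inclusionProb, add_comm n θ]
    rfl

/-- The second-moment recursion minus the product of the two mean recursions; the newcomer's
deterministic contribution cancels. `q - p ^ 2` is the dependence between two distinct vertices in a
sample without replacement, and the `diagDiff` term comes from a vertex paired with itself. -/
theorem levelCov_succ (hS : IsHyperrecursiveTree P θ S) (hθ : 2 ≤ θ) (n i j : ℕ) {p q : ℝ}
    (hp : p = inclusionProb ((θ : ℝ) - 1) ((n + θ : ℕ) : ℝ))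
    (hq : q = pairProb ((θ : ℝ) - 1) ((n + θ : ℕ) : ℝ)) :
    levelCov P θ S (n + 1) (i + 1) (j + 1) =
      (1 - 2 * p + q) * levelCov P θ S n (i + 1) (j + 1) +
      (p - q) * (levelCov P θ S n (i + 1) j + levelCov P θ S n i (j + 1)) +
      q * levelCov P θ S n i j +
      (q - p ^ 2) * ((levelMean P θ S n i - levelMean P θ S n (i + 1)) *
        (levelMean P θ S n j - levelMean P θ S n (j + 1))) +
      (p - q) * diagDiff (levelMean P θ S n) i j := by
  have hr : (((θ - 1 : ℕ) : ℕ) : ℝ) = (θ : ℝ) - 1 := by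
    rw [Nat.cast_sub (by omega), Nat.cast_one]
  have h1 := (hS.hasMean_levelCount_mul (n + 1) (i + 1) (j + 1)).2
  simp_rw [fun ω i => levelCount_succ (c := fun t => S t ω) (hS.subset_range ω) n i] at h1
  rw [hS.integral_step (n := n)
    (f := fun c s => ((levelCount θ c n (i + 1) : ℝ) + (if i = 0 then 1 else 0) +
      ((s ∩ levelSet θ c n i).card : ℝ) - ((s ∩ levelSet θ c n (i + 1)).card : ℝ)) *
      ((levelCount θ c n (j + 1) : ℝ) + (if j = 0 then 1 else 0) +
      ((s ∩ levelSet θ c n j).card : ℝ) - ((s ∩ levelSet θ c n (j + 1)).card : ℝ)))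
    (g := fun c => (1 - 2 * p + q) *
        ((levelCount θ c n (i + 1) : ℝ) * (levelCount θ c n (j + 1) : ℝ)) +
      (p - q) * ((levelCount θ c n (i + 1) : ℝ) * (levelCount θ c n j : ℝ) +
        (levelCount θ c n i : ℝ) * (levelCount θ c n (j + 1) : ℝ)) +
      q * ((levelCount θ c n i : ℝ) * (levelCount θ c n j : ℝ)) +
      (if j = 0 then 1 else 0) * ((levelCount θ c n (i + 1) : ℝ) +
        p * ((levelCount θ c n i : ℝ) - (levelCount θ c n (i + 1) : ℝ))) +
      (if i = 0 then 1 else 0) * ((levelCount θ c n (j + 1) : ℝ) +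
        p * ((levelCount θ c n j : ℝ) - (levelCount θ c n (j + 1) : ℝ))) +
      (if i = 0 then 1 else 0) * (if j = 0 then 1 else 0) +
      (p - q) * diagDiff (fun l => (levelCount θ c n l : ℝ)) i j)] at h1
  · have x := hS.hasMean_levelCount n
    have xx := hS.hasMean_levelCount_mul n
    -- The mean of the averaged expression `g`, term by term and in the same order.
    have hm := ((((((((xx (i + 1) (j + 1)).const_mul (1 - 2 * p + q)).add
      (((xx (i + 1) j).add (xx i (j + 1))).const_mul (p - q))).add
      ((xx i j).const_mul q)).add
      (((x (i + 1)).add (((x i).sub (x (i + 1))).const_mul p)).const_mul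
        (if j = 0 then 1 else 0))).add
      (((x (j + 1)).add (((x j).sub (x (j + 1))).const_mul p)).const_mul
        (if i = 0 then 1 else 0))).add
      (HasMean.const ((if i = 0 then 1 else 0) * (if j = 0 then 1 else 0)))).add
      ((((((x i).ite_zero (i = j)).sub ((x i).ite_zero (i = j + 1))).sub
        ((x (i + 1)).ite_zero (i + 1 = j))).add
        ((x (i + 1)).ite_zero (i + 1 = j + 1))).const_mul (p - q))).2
    have h2 := h1.symm.trans hm
    rw [hS.levelMean_succ hθ, hS.levelMean_succ hθ, ← hp] at h2
    unfold diagDiff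
    linear_combination h2
  · intro c c' h
    simp only [levelCount_congr h, levelSet_congr h]
  · intro c
    rw [sum_powersetCard_affine_mul_affine (by omega) (levelSet_subset ..) (levelSet_subset ..)
      (levelSet_subset ..) (levelSet_subset ..)]
    simp only [levelSet_inter_levelSet, apply_ite Finset.card, card_levelSet, Finset.card_empty,
      apply_ite (Nat.cast : ℕ → ℝ), Nat.cast_zero, diagDiff, Finset.card_range]
    rw [hr, add_comm θ n]
    change _ = inclusionProb ((θ : ℝ) - 1) ((n + θ : ℕ) : ℝ) at hp
    unfold inclusionProb at hp
    unfold pairProb at hq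
    rw [← hp, ← hq]
    ring

end IsHyperrecursiveTree

/-! ### The limiting means and covariances -/

/-- The limiting proportion of vertices at containment level `i`. -/
def levelFreq (s : ℝ) : ℕ → ℝ
  | 0 => 0
  | i + 1 => (s * levelFreq s i + if i = 0 then 1 else 0) / (1 + s)

/-- The limiting conditional covariance of the increments at the levels `i + 1` and `j + 1`. -/
def levelNoise (s : ℝ) (i j : ℕ) : ℝ :=
  s * diagDiff (levelFreq s) i j -
    s * ((levelFreq s i - levelFreq s (i + 1)) * (levelFreq s j - levelFreq s (j + 1)))

/-- The limiting covariances of the containment levels, per vertex. -/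
def covLimit (s : ℝ) : ℕ → ℕ → ℝ
  | 0, _ => 0
  | _ + 1, 0 => 0
  | i + 1, j + 1 => (s * (covLimit s (i + 1) j + covLimit s i (j + 1)) + levelNoise s i j) /
      (1 + 2 * s)
termination_by i j => i + j

theorem tendsto_inclusionProb_mul (s : ℝ) {d : ℕ} (hd : 0 < d) :
    Tendsto (fun n : ℕ => inclusionProb s ((n + d : ℕ) : ℝ) * ((n + d : ℕ) : ℝ)) atTop
      (nhds s) := by
  refine tendsto_const_nhds.congr fun n => ?_
  have : ((n + d : ℕ) : ℝ) ≠ 0 := Nat.cast_ne_zero.2 (by omega)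
  rw [inclusionProb, div_mul_cancel₀ _ this]

theorem tendsto_pairProb_mul (s : ℝ) {d : ℕ} (hd : 2 ≤ d) :
    Tendsto (fun n : ℕ => pairProb s ((n + d : ℕ) : ℝ) * ((n + d : ℕ) : ℝ)) atTop (nhds 0) := by
  have h : Tendsto (fun n : ℕ => s * (s - 1) / (((n + d : ℕ) : ℝ) - 1)) atTop (nhds 0) :=
    ((tendsto_natCast_add_atTop d).atTop_add tendsto_const_nhds).const_div_atTop _
  refine h.congr fun n => ?_
  have h2 : (2 : ℝ) ≤ ((n + d : ℕ) : ℝ) := by exact_mod_cast (by omega : 2 ≤ n + d)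
  have h3 : ((n + d : ℕ) : ℝ) - 1 ≠ 0 := by linarith
  have h4 : ((n + d : ℕ) : ℝ) ≠ 0 := by linarith
  rw [pairProb]
  field_simp

/-- Products of means grow like `t ^ 2`, so `q` matters here to order `t ^ (-2)`: the limit of `(q -
p ^ 2) t ^ 2` is `s (s - 1) - s ^ 2 = -s`, the negative term of `levelNoise`. -/
theorem tendsto_pairProb_mul_sq (s : ℝ) {d : ℕ} (hd : 2 ≤ d) :
    Tendsto (fun n : ℕ => pairProb s ((n + d : ℕ) : ℝ) * ((n + d : ℕ) : ℝ) ^ 2) atTop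
      (nhds (s * (s - 1))) := by
  have h := (tendsto_pairProb_mul s hd).const_add (s * (s - 1))
  rw [add_zero] at h
  refine h.congr fun n => ?_
  have h2 : (2 : ℝ) ≤ ((n + d : ℕ) : ℝ) := by exact_mod_cast (by omega : 2 ≤ n + d)
  have h3 : ((n + d : ℕ) : ℝ) - 1 ≠ 0 := by linarith
  have h4 : ((n + d : ℕ) : ℝ) ≠ 0 := by linarith
  rw [pairProb]
  field_simp
  ring

namespace IsHyperrecursiveTree

variable [IsProbabilityMeasure P]

theorem tendsto_levelMean_div (hS : IsHyperrecursiveTree P θ S) (hθ : 2 ≤ θ) (i : ℕ) :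
    Tendsto (fun n => levelMean P θ S n i / ((n + θ : ℕ) : ℝ)) atTop
      (nhds (levelFreq ((θ : ℝ) - 1) i)) := by
  have hs : (0 : ℝ) ≤ (θ : ℝ) - 1 := by
    have : (2 : ℝ) ≤ θ := by exact_mod_cast hθ
    linarith
  induction i with
  | zero => simp [levelMean, levelCount_zero, levelFreq]
  | succ i ih =>
    refine tendsto_div_of_recursion (β := fun _ => (θ : ℝ) - 1)
      (b := fun n => ((θ : ℝ) - 1) * (levelMean P θ S n i / ((n + θ : ℕ) : ℝ)) +
        if i = 0 then 1 else 0) hs θ (by omega) tendsto_const_nhds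
      ((ih.const_mul _).add_const _) fun n => ?_
    rw [hS.levelMean_succ hθ, inclusionProb]
    ring

theorem tendsto_diagDiff (hS : IsHyperrecursiveTree P θ S) (hθ : 2 ≤ θ) (i j : ℕ) :
    Tendsto (fun n => diagDiff (levelMean P θ S n) i j / ((n + θ : ℕ) : ℝ)) atTop
      (nhds (diagDiff (levelFreq ((θ : ℝ) - 1)) i j)) := by
  have h : ∀ (p : Prop) [Decidable p] (l : ℕ),
      Tendsto (fun n => (if p then levelMean P θ S n l else 0) / ((n + θ : ℕ) : ℝ)) atTop
        (nhds (if p then levelFreq ((θ : ℝ) - 1) l else 0)) := fun p _ l => by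
    split_ifs
    · exact hS.tendsto_levelMean_div hθ l
    · simp
  unfold diagDiff
  simp_rw [add_div, sub_div]
  exact (((h _ _).sub (h _ _)).sub (h _ _)).add (h _ _)

theorem tendsto_levelCov_div (hS : IsHyperrecursiveTree P θ S) (hθ : 2 ≤ θ) (i j : ℕ) :
    Tendsto (fun n => levelCov P θ S n i j / ((n + θ : ℕ) : ℝ)) atTop
      (nhds (covLimit ((θ : ℝ) - 1) i j)) := by
  have hs : (0 : ℝ) ≤ (θ : ℝ) - 1 := by
    have : (2 : ℝ) ≤ θ := by exact_mod_cast hθ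
    linarith
  induction i generalizing j with
  | zero => simp [levelCov, levelCount_zero, covLimit, covariance]
  | succ i ihi =>
    induction j with
    | zero => simp [levelCov, levelCount_zero, covLimit, covariance]
    | succ j ihj =>
      set s : ℝ := (θ : ℝ) - 1 with hsdef
      have hp := tendsto_inclusionProb_mul s (d := θ) (by omega)
      have hq := tendsto_pairProb_mul s hθ
      have hq2 := tendsto_pairProb_mul_sq s hθ
      have hx := fun l => hS.tendsto_levelMean_div hθ l
      -- Powers of `t` are shared out so that every factor converges: `p · cov = (p t) (cov / t)`,
      -- and two factors `t` go to `q - p ^ 2`. The term `q · cov` at levels `(i, j)` vanishes in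
      -- the limit.
      have hb := ((((hp.sub hq).mul (ihj.add (ihi (j + 1)))).add (hq.mul (ihi j))).add
        ((hq2.sub (hp.pow 2)).mul (((hx i).sub (hx (i + 1))).mul ((hx j).sub (hx (j + 1)))))).add
        ((hp.sub hq).mul (hS.tendsto_diagDiff hθ i j))
      have hβ := (hp.const_mul 2).sub hq
      rw [sub_zero] at hβ
      have := tendsto_div_of_recursion (a := fun n => levelCov P θ S n (i + 1) (j + 1))
        (by linarith : 0 ≤ 2 * s) θ (by omega) hβ hb fun n => ?_
      · convert this using 2
        rw [covLimit, levelNoise]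
        congr 1
        simp only [← hsdef]
        ring
      · rw [hS.levelCov_succ hθ n i j rfl rfl]
        have h4 : ((n + θ : ℕ) : ℝ) ≠ 0 := Nat.cast_ne_zero.2 (by omega)
        simp only [← hsdef]
        generalize inclusionProb s ((n + θ : ℕ) : ℝ) = p
        generalize pairProb s ((n + θ : ℕ) : ℝ) = q
        field_simp
        ring

end IsHyperrecursiveTree

end

/-! ### A scalar linear differential equation on the half-line -/

/-- With the integrating factor, `exp (c m) f - K / (c - 1) exp ((c - 1) m)` is nonincreasing. Since
`c > 1`, the rate `exp (-m)` of the forcing is inherited without polynomial factors and survives an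
induction. -/
theorem le_mul_exp_neg_of_hasDerivAt {f h : ℝ → ℝ} {c K : ℝ} (hc : 1 < c) (hK : 0 ≤ K)
    (hf : ∀ m, HasDerivAt f (h m - c * f m) m) (hh : ∀ m, 0 ≤ m → h m ≤ K * Real.exp (-m)) :
    ∀ m, 0 ≤ m → f m ≤ (|f 0| + K / (c - 1)) * Real.exp (-m) := by
  intro m hm
  set g : ℝ → ℝ := fun m => Real.exp (c * m) * f m - K / (c - 1) * Real.exp ((c - 1) * m) with hg
  have hlin : ∀ (a x : ℝ), HasDerivAt (fun y => Real.exp (a * y)) (Real.exp (a * x) * a) x :=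
    fun a x => by simpa using ((hasDerivAt_id x).const_mul a).exp
  have hd : ∀ x, HasDerivAt g
      (Real.exp (c * x) * h x - K * Real.exp ((c - 1) * x)) x := fun x => by
    have := ((hlin c x).mul (hf x)).sub ((hlin (c - 1) x).const_mul (K / (c - 1)))
    refine this.congr_deriv ?_
    have : c - 1 ≠ 0 := by linarith
    field_simp
    ring
  have hanti : AntitoneOn g (Set.Ici 0) := by
    refine antitoneOn_of_deriv_nonpos (convex_Ici 0)
      (fun x _ => (hd x).continuousAt.continuousWithinAt)
      (fun x _ => (hd x).differentiableAt.differentiableWithinAt) fun x hx => ?_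
    rw [interior_Ici] at hx
    rw [(hd x).deriv, sub_nonpos]
    calc Real.exp (c * x) * h x ≤ Real.exp (c * x) * (K * Real.exp (-x)) :=
          mul_le_mul_of_nonneg_left (hh x hx.le) (Real.exp_pos _).le
      _ = K * Real.exp ((c - 1) * x) := by
          rw [mul_left_comm, ← Real.exp_add]
          ring_nf
  have h1 := hanti (Set.self_mem_Ici) (Set.mem_Ici.2 hm) hm
  simp only [hg, mul_zero, Real.exp_zero, one_mul, mul_one] at h1
  have hKc : 0 ≤ K / (c - 1) := div_nonneg hK (by linarith)
  have he : 1 ≤ Real.exp ((c - 1) * m) := Real.one_le_exp (mul_nonneg (by linarith) hm)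
  have h2 : Real.exp (c * m) * f m ≤ (|f 0| + K / (c - 1)) * Real.exp ((c - 1) * m) := by
    have := mul_le_mul_of_nonneg_left he (abs_nonneg (f 0))
    have := le_abs_self (f 0)
    linarith
  have h3 : f m = Real.exp (-(c * m)) * (Real.exp (c * m) * f m) := by
    rw [← mul_assoc, ← Real.exp_add, neg_add_cancel, Real.exp_zero, one_mul]
  rw [h3]
  refine (mul_le_mul_of_nonneg_left h2 (Real.exp_pos _).le).trans_eq ?_
  rw [mul_left_comm, ← Real.exp_add]
  ring_nf

/-- The bound applied to `f` and `-f` gives decay; integrating `f' = h - c f` from `0` to `∞` then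
gives `-f 0 = ∫ h - c ∫ f`. -/
theorem integrableOn_and_integral_of_hasDerivAt {f h : ℝ → ℝ} {c K : ℝ} (hc : 1 < c) (hK : 0 ≤ K)
    (hf : ∀ m, HasDerivAt f (h m - c * f m) m) (hh : ∀ m, 0 ≤ m → |h m| ≤ K * Real.exp (-m))
    (hint : IntegrableOn h (Set.Ioi 0)) :
    (∃ K', 0 ≤ K' ∧ ∀ m, 0 ≤ m → |f m| ≤ K' * Real.exp (-m)) ∧ IntegrableOn f (Set.Ioi 0) ∧
      ∫ m in Set.Ioi 0, f m = (f 0 + ∫ m in Set.Ioi 0, h m) / c := by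
  set K' : ℝ := |f 0| + K / (c - 1) with hK'
  have hKc : 0 ≤ K / (c - 1) := div_nonneg hK (by linarith)
  have hb : ∀ m, 0 ≤ m → |f m| ≤ K' * Real.exp (-m) := fun m hm => by
    have h1 := le_mul_exp_neg_of_hasDerivAt hc hK hf (fun m hm => (le_abs_self _).trans (hh m hm))
      m hm
    have h2 := le_mul_exp_neg_of_hasDerivAt (f := fun m => -f m) (h := fun m => -h m) hc hK
      (fun m => (hf m).neg.congr_deriv (by ring))
      (fun m hm => (neg_le_abs _).trans (hh m hm)) m hm
    rw [abs_neg] at h2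
    exact abs_le'.2 ⟨h1, h2⟩
  have hfc : Continuous f := continuous_iff_continuousAt.2 fun m => (hf m).continuousAt
  have hfi : IntegrableOn f (Set.Ioi 0) := by
    refine ((integrableOn_exp_neg_Ioi 0).const_mul K').mono' hfc.aestronglyMeasurable ?_
    filter_upwards [ae_restrict_mem measurableSet_Ioi] with m hm
    exact hb m (Set.mem_Ioi.1 hm).le
  refine ⟨⟨K', by positivity, hb⟩, hfi, ?_⟩
  have hlim : Tendsto f atTop (nhds 0) := by
    have h0 : Tendsto (fun m => K' * Real.exp (-m)) atTop (nhds 0) := by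
      simpa using Real.tendsto_exp_neg_atTop_nhds_zero.const_mul K'
    refine squeeze_zero_norm' ?_ h0
    filter_upwards [eventually_ge_atTop 0] with m hm
    exact hb m hm
  have h1 := integral_Ioi_of_hasDerivAt_of_tendsto' (fun x _ => hf x)
    (hint.sub (hfi.const_mul c)) hlim
  rw [integral_sub hint (hfi.const_mul c), integral_const_mul] at h1
  rw [eq_div_iff (by linarith)]
  linarith

/-! ### The core matrix -/

/-- The entry of `x` at the color of level `l`, for the levels `1, …, k`. -/
def atLevel {k : ℕ} (x : Fin (k + 1) → ℝ) : ℕ → ℝ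
  | 0 => 0
  | l + 1 => if h : l < k then x (Fin.castSucc ⟨l, h⟩) else 0

theorem atLevel_succ {k : ℕ} (x : Fin (k + 1) → ℝ) (j : Fin k) :
    atLevel x (j + 1) = x j.castSucc := by
  simp [atLevel]

/-- Subtracting `1` in `Fin (k + 1)` wraps around only at `0`, where `replacementVector` uses its
other branch. -/
theorem succ_sub_one {k : ℕ} (j : Fin k) : j.succ - 1 = j.castSucc :=
  sub_eq_of_eq_add Fin.coeSucc_eq_succ.symm

theorem coreMatrix_mulVec_one (θ k : ℕ) : (coreMatrix θ k).mulVec (fun _ => 1) = fun _ => 1 := by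
  ext i
  simp only [Matrix.mulVec, dotProduct, mul_one, coreMatrix, Matrix.of_apply, replacementVector,
    Finset.sum_sub_distrib]
  rw [Fin.sum_univ_succ, Fin.sum_univ_castSucc]
  simp [Fin.succ_ne_zero, Fin.castSucc_ne_last, succ_sub_one]

/-- The total mass enters only the first coordinate; otherwise `A` acts by `s` times a backward
difference. On vectors of sum zero the first `k` coordinates thus form a closed triangular system.
-/
theorem vecMul_coreMatrix_castSucc (θ k : ℕ) (x : Fin (k + 1) → ℝ) (j : Fin k) :
    Matrix.vecMul x (coreMatrix θ k) j.castSucc =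
      (if (j : ℕ) = 0 then ∑ i, x i else 0) +
        ((θ : ℝ) - 1) * (atLevel x j - atLevel x (j + 1)) := by
  have h : ∀ l : Fin (k + 1), ∑ i, x i * (Pi.single i ((θ : ℝ) - 1) : Fin (k + 1) → ℝ) l =
      ((θ : ℝ) - 1) * x l :=
    fun l => by
      rw [Finset.sum_eq_single l]
      · rw [Pi.single_eq_same, mul_comm]
      · intro b _ hb
        rw [Pi.single_eq_of_ne hb.symm, mul_zero]
      · simp
  simp only [Matrix.vecMul, dotProduct, coreMatrix, Matrix.of_apply, replacementVector, mul_sub,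
    Finset.sum_sub_distrib, atLevel_succ]
  simp only [(Fin.castSucc_lt_last j).ne, if_false, h]
  by_cases hj : (j : ℕ) = 0
  · have : j.castSucc = 0 := Fin.ext hj
    simp [this, hj, atLevel, sub_eq_add_neg]
  · obtain ⟨l, hl⟩ : ∃ l, (j : ℕ) = l + 1 := ⟨j - 1, by omega⟩
    have hlk : l < k := by omega
    have h0 : j.castSucc ≠ 0 := fun h => hj (by simpa using congrArg Fin.val h)
    have h1 : j.castSucc = (⟨l, hlk⟩ : Fin k).succ := Fin.ext hl
    have h2 : j.castSucc - 1 = (⟨l, hlk⟩ : Fin k).castSucc := by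
      rw [h1, succ_sub_one]
    simp only [h0, if_false, h, hj, h2]
    rw [hl]
    simp [atLevel, hlk]

theorem transpose_coreMatrix_mul_castSucc {θ k : ℕ}
    {M : Matrix (Fin (k + 1)) (Fin (k + 1)) ℝ} (hM : Matrix.vecMul (fun _ => 1) M = 0)
    (i : Fin k) (j : Fin (k + 1)) :
    ((coreMatrix θ k).transpose * M) i.castSucc j =
      ((θ : ℝ) - 1) * (atLevel (fun l => M l j) i - atLevel (fun l => M l j) (i + 1)) := by
  have h : ((coreMatrix θ k).transpose * M) i.castSucc j =
      Matrix.vecMul (fun l => M l j) (coreMatrix θ k) i.castSucc := by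
    simp [Matrix.mul_apply, Matrix.vecMul, dotProduct, mul_comm]
  have h0 : ∑ l, M l j = 0 := by
    simpa [Matrix.vecMul, dotProduct] using congrFun hM j
  rw [h, vecMul_coreMatrix_castSucc, h0, ite_self, zero_add]

theorem mul_coreMatrix_castSucc {θ k : ℕ}
    {M : Matrix (Fin (k + 1)) (Fin (k + 1)) ℝ} (hM : M.mulVec (fun _ => 1) = 0)
    (i : Fin (k + 1)) (j : Fin k) :
    (M * coreMatrix θ k) i j.castSucc =
      ((θ : ℝ) - 1) * (atLevel (M i) j - atLevel (M i) (j + 1)) := by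
  have h : (M * coreMatrix θ k) i j.castSucc =
      Matrix.vecMul (M i) (coreMatrix θ k) j.castSucc := by
    simp [Matrix.mul_apply, Matrix.vecMul, dotProduct]
  have h0 : ∑ l, M i l = 0 := by
    simpa [Matrix.mulVec, dotProduct] using congrFun hM i
  rw [h, vecMul_coreMatrix_castSucc, h0, ite_self, zero_add]

theorem eq_of_castSucc_of_sum {k : ℕ} {x y : Fin (k + 1) → ℝ}
    (h : ∀ j : Fin k, x j.castSucc = y j.castSucc) (hs : ∑ i, x i = ∑ i, y i) : x = y := by
  rw [Fin.sum_univ_castSucc, Fin.sum_univ_castSucc, Finset.sum_congr rfl fun j _ => h j] at hs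
  ext i
  induction i using Fin.lastCases with
  | last => exact add_left_cancel hs
  | cast j => exact h j

/-- With total mass one, the first `k` coordinates of `v A = v` are exactly the recursion defining
`levelFreq`. -/
theorem atLevel_principal {θ k : ℕ} (hθ : 2 ≤ θ) {v : Fin (k + 1) → ℝ}
    (hv : IsPrincipalLeftEigenvector (coreMatrix θ k) v) {l : ℕ} (hl : l ≤ k) :
    atLevel v l = levelFreq ((θ : ℝ) - 1) l := by
  have hs : (2 : ℝ) ≤ θ := by exact_mod_cast hθ
  induction l with
  | zero => rfl
  | succ l ih =>
    have h := congrFun hv.vecMul_eq (Fin.castSucc ⟨l, hl⟩)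
    rw [vecMul_coreMatrix_castSucc, hv.sum_eq_one, ← atLevel_succ v ⟨l, hl⟩] at h
    simp only at h
    rw [ih (by omega)] at h
    rw [levelFreq, eq_div_iff (by linarith)]
    linarith

theorem existsUnique_principal {θ : ℕ} (k : ℕ) (hθ : 2 ≤ θ) :
    ∃! v : Fin (k + 1) → ℝ, IsPrincipalLeftEigenvector (coreMatrix θ k) v := by
  have hs : (2 : ℝ) ≤ θ := by exact_mod_cast hθ
  set s : ℝ := (θ : ℝ) - 1 with hsdef
  set v : Fin (k + 1) → ℝ := Fin.snoc (α := fun _ => ℝ) (fun j : Fin k => levelFreq s (j + 1))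
    (1 - ∑ j : Fin k, levelFreq s (j + 1)) with hv
  have hvc : ∀ j : Fin k, v j.castSucc = levelFreq s (j + 1) := fun j => by simp [hv]
  have hsum : ∑ i, v i = 1 := by
    rw [Fin.sum_univ_castSucc]
    simp [hv]
  have hlev : ∀ l ≤ k, atLevel v l = levelFreq s l := fun l hl => by
    cases l with
    | zero => rfl
    | succ l => exact (atLevel_succ v ⟨l, hl⟩).trans (hvc ⟨l, hl⟩)
  refine ⟨v, ⟨eq_of_castSucc_of_sum (fun j => ?_) ?_, hsum⟩, fun w hw =>
    eq_of_castSucc_of_sum (fun j => ?_) (hw.sum_eq_one.trans hsum.symm)⟩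
  · rw [vecMul_coreMatrix_castSucc, hsum, hlev _ j.2.le, hlev _ j.2, hvc, ← hsdef, levelFreq]
    have : 1 + s ≠ 0 := by linarith
    field_simp
    ring
  -- The last coordinate of the eigenvector equation follows from the others, because `A 𝟏ᵀ = 𝟏ᵀ`
  -- makes `v A` and `v` have the same sum.
  · have h := Matrix.dotProduct_mulVec v (coreMatrix θ k) fun _ => 1
    rw [coreMatrix_mulVec_one] at h
    simpa [dotProduct] using h.symm
  · rw [hvc, ← atLevel_succ w j, atLevel_principal hθ hw j.2]

/-! ### The integrand at the principal left eigenvector -/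

section Projection

variable {ι : Type*} [Fintype ι] [DecidableEq ι] {A : Matrix ι ι ℝ} {v : ι → ℝ}

theorem commute_projHat (hA : A.mulVec (fun _ => 1) = fun _ => 1)
    (hv : IsPrincipalLeftEigenvector A v) : Commute (projHat v) A := by
  rw [Commute, SemiconjBy, projHat, sub_mul, mul_sub, Matrix.vecMulVec_mul, Matrix.mul_vecMulVec,
    hv.vecMul_eq, hA, one_mul, mul_one]

theorem projHat_mulVec_one (hv : ∑ i, v i = 1) : (projHat v).mulVec (fun _ => 1) = 0 := by
  rw [projHat, Matrix.sub_mulVec, Matrix.one_mulVec, Matrix.vecMulVec_mulVec]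
  ext i
  simp [dotProduct, hv]

/-- `P̂` commutes with `exp (m A)` and kills the all-ones column. Zero row sums, and likewise zero
column sums, remove the mass term in the action of `A`. -/
theorem sigmaIntegrand_mulVec_one (hA : A.mulVec (fun _ => 1) = fun _ => 1)
    (hv : IsPrincipalLeftEigenvector A v) (s m : ℝ) :
    (sigmaIntegrand A s v m).mulVec (fun _ => 1) = 0 := by
  have h : Commute (projHat v) (NormedSpace.exp (m • A)) :=
    ((commute_projHat hA hv).smul_right m).exp_right
  rw [sigmaIntegrand, mul_assoc, h.eq, ← mul_assoc, Matrix.smul_mulVec, ← Matrix.mulVec_mulVec,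
    projHat_mulVec_one hv.sum_eq_one, Matrix.mulVec_zero, smul_zero]

theorem one_vecMul_sigmaIntegrand (hA : A.mulVec (fun _ => 1) = fun _ => 1)
    (hv : IsPrincipalLeftEigenvector A v) (s m : ℝ) :
    Matrix.vecMul (fun _ => 1) (sigmaIntegrand A s v m) = 0 := by
  have h0 : Commute (projHat v).transpose A.transpose := by
    have := congrArg Matrix.transpose (commute_projHat hA hv).eq
    rw [Matrix.transpose_mul, Matrix.transpose_mul] at this
    exact this.symm
  have h : Commute (projHat v).transpose (NormedSpace.exp (m • A.transpose)) :=
    (h0.smul_right m).exp_right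
  rw [sigmaIntegrand, ← h.eq, mul_assoc, mul_assoc, mul_assoc, Matrix.vecMul_smul,
    ← Matrix.vecMul_vecMul, Matrix.vecMul_transpose, projHat_mulVec_one hv.sum_eq_one,
    Matrix.zero_vecMul, smul_zero]

/-- The covariance matrix `s diag(v) - s vᵀ v` of the limiting sample. -/
def sampleCov (s : ℝ) (v : ι → ℝ) : Matrix ι ι ℝ :=
  s • Matrix.diagonal v - s • Matrix.vecMulVec v v

theorem sampleCov_mulVec_one (s : ℝ) (hv : ∑ i, v i = 1) :
    (sampleCov s v).mulVec (fun _ => 1) = 0 := by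
  rw [sampleCov, Matrix.sub_mulVec, Matrix.smul_mulVec, Matrix.smul_mulVec,
    Matrix.vecMulVec_mulVec]
  ext i
  simp [dotProduct, hv, Matrix.mulVec_diagonal]

theorem transpose_sampleCov {κ : Type*} [DecidableEq κ] (s : ℝ) (v : κ → ℝ) :
    (sampleCov s v).transpose = sampleCov s v := by
  rw [sampleCov, Matrix.transpose_sub, Matrix.transpose_smul, Matrix.transpose_smul,
    Matrix.diagonal_transpose, Matrix.transpose_vecMulVec]

theorem one_vecMul_sampleCov (s : ℝ) (hv : ∑ i, v i = 1) :
    Matrix.vecMul (fun _ => 1) (sampleCov s v) = 0 := by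
  rw [← transpose_sampleCov, Matrix.vecMul_transpose, sampleCov_mulVec_one s hv]

/-- Since `𝒬 𝟏ᵀ = s ^ 2 vᵀ`, the projection subtracts `s ^ 2 vᵀ v`: it turns the second-moment
matrix into a covariance matrix, which the projection on the other side leaves fixed. -/
theorem secondMoment_mul_projHat (s : ℝ) (hv : ∑ i, v i = 1) :
    ((s * (s - 1)) • Matrix.vecMulVec v v + s • Matrix.diagonal v) * projHat v =
      sampleCov s v := by
  have h : ((s * (s - 1)) • Matrix.vecMulVec v v + s • Matrix.diagonal v).mulVec (fun _ => 1) =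
      s ^ 2 • v := by
    rw [Matrix.add_mulVec, Matrix.smul_mulVec, Matrix.smul_mulVec, Matrix.vecMulVec_mulVec]
    ext i
    simp [dotProduct, hv, Matrix.mulVec_diagonal]
    ring
  rw [projHat, mul_sub, mul_one, Matrix.mul_vecMulVec, h, sampleCov, Matrix.smul_vecMulVec]
  module

theorem transpose_projHat_mul_sampleCov (s : ℝ) (hv : ∑ i, v i = 1) :
    (projHat v).transpose * sampleCov s v = sampleCov s v := by
  rw [projHat, Matrix.transpose_sub, Matrix.transpose_one, Matrix.transpose_vecMulVec, sub_mul,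
    one_mul, Matrix.vecMulVec_mul, one_vecMul_sampleCov s hv, Matrix.vecMulVec_zero, sub_zero]

theorem sigmaIntegrand_zero (hA : A.mulVec (fun _ => 1) = fun _ => 1)
    (hv : IsPrincipalLeftEigenvector A v) (s : ℝ) :
    sigmaIntegrand A s v 0 = (s ^ 2)⁻¹ • (A.transpose * (sampleCov s v * A)) := by
  have h1 := (commute_projHat hA hv).eq
  have h2 := congrArg Matrix.transpose h1
  rw [Matrix.transpose_mul, Matrix.transpose_mul] at h2
  rw [sigmaIntegrand, matrixB]
  simp only [neg_zero, Real.exp_zero, one_smul, zero_smul, NormedSpace.exp_zero, one_mul, mul_one,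
    Matrix.mul_smul, Matrix.smul_mul]
  congr 1
  rw [mul_assoc, mul_assoc _ A, ← h1, ← mul_assoc _ (projHat v) A, mul_assoc A.transpose,
    secondMoment_mul_projHat s hv.sum_eq_one, ← mul_assoc, ← mul_assoc, ← h2, mul_assoc,
    mul_assoc, ← mul_assoc _ (sampleCov s v) A, transpose_projHat_mul_sampleCov s hv.sum_eq_one]

-- The product rule for `F' = Aᵀ F + F A - F`. The norm serves only to differentiate the matrix
-- exponential.
attribute [local instance] Matrix.linftyOpNormedRing Matrix.linftyOpNormedAlgebra in
theorem hasDerivAt_sigmaIntegrand (A : Matrix ι ι ℝ) (s : ℝ) (v : ι → ℝ) (m : ℝ) (i j : ι) :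
    HasDerivAt (fun m => sigmaIntegrand A s v m i j)
      ((A.transpose * sigmaIntegrand A s v m) i j + (sigmaIntegrand A s v m * A) i j -
        sigmaIntegrand A s v m i j) m := by
  have h1 := hasDerivAt_exp_smul_const' (𝕂 := ℝ) A.transpose m
  have h2 := hasDerivAt_exp_smul_const (𝕂 := ℝ) A m
  have h3 : HasDerivAt (fun m : ℝ => Real.exp (-m)) (-Real.exp (-m)) m := by
    simpa using (hasDerivAt_neg m).exp
  have h := h3.smul ((((h1.mul_const (projHat v).transpose).mul_const (matrixB A s v)).mul_const
    (projHat v)).mul h2)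
  have h4 := ((Matrix.entryLinearMap ℝ ℝ i j).toContinuousLinearMap.hasFDerivAt).comp_hasDerivAt m h
  refine h4.congr_deriv ?_
  have : A.transpose * sigmaIntegrand A s v m + sigmaIntegrand A s v m * A -
      sigmaIntegrand A s v m = Real.exp (-m) • (A.transpose * NormedSpace.exp (m • A.transpose) *
        (projHat v).transpose * matrixB A s v * projHat v * NormedSpace.exp (m • A) +
        NormedSpace.exp (m • A.transpose) * (projHat v).transpose * matrixB A s v * projHat v *
          (NormedSpace.exp (m • A) * A)) + -Real.exp (-m) •
        (NormedSpace.exp (m • A.transpose) * (projHat v).transpose * matrixB A s v *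
          projHat v * NormedSpace.exp (m • A)) := by
    simp only [sigmaIntegrand, Matrix.mul_smul, Matrix.smul_mul, mul_assoc, smul_add]
    module
  exact (congrFun (congrFun this i) j).symm

end Projection

/-! ### The entries of the limiting matrix -/

/-- The entry of `M` at the colors of levels `a` and `b`, for the levels `1, …, k`. -/
def atLevels {k : ℕ} (M : Matrix (Fin (k + 1)) (Fin (k + 1)) ℝ) (a b : ℕ) : ℝ :=
  atLevel (fun i => atLevel (M i) b) a

theorem atLevel_sub {k : ℕ} (x y : Fin (k + 1) → ℝ) (l : ℕ) :
    atLevel (fun i => x i - y i) l = atLevel x l - atLevel y l := by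
  cases l with
  | zero => simp [atLevel]
  | succ l => by_cases h : l < k <;> simp [atLevel, h]

theorem atLevel_const_mul {k : ℕ} (c : ℝ) (x : Fin (k + 1) → ℝ) (l : ℕ) :
    atLevel (fun i => c * x i) l = c * atLevel x l := by
  cases l with
  | zero => simp [atLevel]
  | succ l => by_cases h : l < k <;> simp [atLevel, h]

theorem atLevels_succ {k : ℕ} (M : Matrix (Fin (k + 1)) (Fin (k + 1)) ℝ) (i j : Fin k) :
    atLevels M (i + 1) (j + 1) = M i.castSucc j.castSucc := by
  rw [atLevels, atLevel_succ, atLevel_succ]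

theorem atLevels_sampleCov {k : ℕ} (s : ℝ) (v : Fin (k + 1) → ℝ) {a b : ℕ} (ha : a ≤ k)
    (hb : b ≤ k) : atLevels (sampleCov s v) a b =
      s * (if a = b then atLevel v a else 0) - s * (atLevel v a * atLevel v b) := by
  cases a with
  | zero => simp [atLevels, atLevel]
  | succ a =>
    cases b with
    | zero => simp [atLevels, atLevel]
    | succ b =>
      rw [atLevels_succ _ ⟨a, ha⟩ ⟨b, hb⟩, atLevel_succ v ⟨a, ha⟩, atLevel_succ v ⟨b, hb⟩]
      by_cases h : a = b
      · subst h
        simp [sampleCov, Matrix.vecMulVec_apply]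
      · simp [sampleCov, Matrix.vecMulVec_apply, h]

variable {θ k : ℕ} {v : Fin (k + 1) → ℝ}

/-- Each factor `A` contributes `s` times a difference in levels. The two factors `s` cancel `s⁻²`,
leaving the mixed second difference of `sampleCov`, which is `levelNoise`. -/
theorem sigmaIntegrand_zero_castSucc (hθ : 2 ≤ θ)
    (hv : IsPrincipalLeftEigenvector (coreMatrix θ k) v) (i j : Fin k) :
    sigmaIntegrand (coreMatrix θ k) ((θ : ℝ) - 1) v 0 i.castSucc j.castSucc =
      levelNoise ((θ : ℝ) - 1) i j := by
  have hs : ((θ : ℝ) - 1) ≠ 0 := by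
    have : (2 : ℝ) ≤ θ := by exact_mod_cast hθ
    linarith
  rw [sigmaIntegrand_zero (coreMatrix_mulVec_one θ k) hv, Matrix.smul_apply, smul_eq_mul,
    transpose_coreMatrix_mul_castSucc]
  · simp_rw [mul_coreMatrix_castSucc (sampleCov_mulVec_one ((θ : ℝ) - 1) hv.sum_eq_one)]
    simp only [atLevel_const_mul, atLevel_sub]
    change ((((θ : ℝ) - 1) ^ 2)⁻¹ * (((θ : ℝ) - 1) * (((θ : ℝ) - 1) *
      (atLevels (sampleCov ((θ : ℝ) - 1) v) i j - atLevels (sampleCov ((θ : ℝ) - 1) v) i (j + 1)) -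
      ((θ : ℝ) - 1) * (atLevels (sampleCov ((θ : ℝ) - 1) v) (i + 1) j -
        atLevels (sampleCov ((θ : ℝ) - 1) v) (i + 1) (j + 1))))) = _
    rw [atLevels_sampleCov _ _ i.2.le j.2.le, atLevels_sampleCov _ _ i.2.le j.2,
      atLevels_sampleCov _ _ i.2 j.2.le, atLevels_sampleCov _ _ i.2 j.2,
      atLevel_principal hθ hv i.2.le, atLevel_principal hθ hv j.2.le,
      atLevel_principal hθ hv i.2, atLevel_principal hθ hv j.2, levelNoise, diagDiff]
    field_simp
    ring
  · rw [← Matrix.vecMul_vecMul, one_vecMul_sampleCov _ hv.sum_eq_one, Matrix.zero_vecMul]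

/-- The two backward differences each contribute `-s` on the diagonal and the factor `exp (-m)`
contributes `-1`, whence the damping `1 + 2 s`. -/
theorem hasDerivAt_atLevels_sigmaIntegrand
    (hv : IsPrincipalLeftEigenvector (coreMatrix θ k) v) {i j : ℕ} (hi : i < k) (hj : j < k)
    (m : ℝ) :
    HasDerivAt (fun m => atLevels (sigmaIntegrand (coreMatrix θ k) ((θ : ℝ) - 1) v m)
        (i + 1) (j + 1))
      (((θ : ℝ) - 1) *
        (atLevels (sigmaIntegrand (coreMatrix θ k) ((θ : ℝ) - 1) v m) (i + 1) j +
          atLevels (sigmaIntegrand (coreMatrix θ k) ((θ : ℝ) - 1) v m) i (j + 1)) -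
        (1 + 2 * ((θ : ℝ) - 1)) *
          atLevels (sigmaIntegrand (coreMatrix θ k) ((θ : ℝ) - 1) v m) (i + 1) (j + 1)) m := by
  have h := hasDerivAt_sigmaIntegrand (coreMatrix θ k) ((θ : ℝ) - 1) v m
    (Fin.castSucc ⟨i, hi⟩) (Fin.castSucc ⟨j, hj⟩)
  have hA := coreMatrix_mulVec_one θ k
  rw [mul_coreMatrix_castSucc (sigmaIntegrand_mulVec_one hA hv _ m),
    transpose_coreMatrix_mul_castSucc (one_vecMul_sigmaIntegrand hA hv _ m)] at h
  have e : (fun m => atLevels (sigmaIntegrand (coreMatrix θ k) ((θ : ℝ) - 1) v m)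
      (i + 1) (j + 1)) = fun m => sigmaIntegrand (coreMatrix θ k) ((θ : ℝ) - 1) v m
        (Fin.castSucc ⟨i, hi⟩) (Fin.castSucc ⟨j, hj⟩) :=
    funext fun m => atLevels_succ _ ⟨i, hi⟩ ⟨j, hj⟩
  rw [e]
  refine h.congr_deriv ?_
  generalize sigmaIntegrand (coreMatrix θ k) ((θ : ℝ) - 1) v m = M
  have e1 : atLevel (fun l => M l (Fin.castSucc ⟨j, hj⟩)) i = atLevels M i (j + 1) := by
    exact congrArg (fun x => atLevel x i) (funext fun l => (atLevel_succ (M l) ⟨j, hj⟩).symm)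
  have e2 : atLevel (M (Fin.castSucc ⟨i, hi⟩)) j = atLevels M (i + 1) j :=
    (atLevel_succ (fun l => atLevel (M l) j) ⟨i, hi⟩).symm
  have e3 := atLevels_succ M ⟨i, hi⟩ ⟨j, hj⟩
  have e4 := atLevel_succ (M (Fin.castSucc ⟨i, hi⟩)) ⟨j, hj⟩
  have e5 := atLevel_succ (fun l => M l (Fin.castSucc ⟨j, hj⟩)) ⟨i, hi⟩
  simp only at e3 e4 e5 ⊢
  rw [e1, e2, e3, e4, e5]
  ring

/-- The decay bound is carried through the induction because the scalar lemma needs it for the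
forcing, made up of entries at lower levels. The integral identity is the recursion of `covLimit`.
-/
theorem atLevels_sigmaIntegrand_integral (hθ : 2 ≤ θ)
    (hv : IsPrincipalLeftEigenvector (coreMatrix θ k) v) {a b : ℕ} (ha : a ≤ k) (hb : b ≤ k) :
    (∃ K, 0 ≤ K ∧ ∀ m, 0 ≤ m →
      |atLevels (sigmaIntegrand (coreMatrix θ k) ((θ : ℝ) - 1) v m) a b| ≤ K * Real.exp (-m)) ∧
    IntegrableOn (fun m => atLevels (sigmaIntegrand (coreMatrix θ k) ((θ : ℝ) - 1) v m) a b)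
      (Set.Ioi 0) ∧
    ∫ m in Set.Ioi 0, atLevels (sigmaIntegrand (coreMatrix θ k) ((θ : ℝ) - 1) v m) a b =
      covLimit ((θ : ℝ) - 1) a b := by
  have hs : 1 ≤ ((θ : ℝ) - 1) := by
    have : (2 : ℝ) ≤ θ := by exact_mod_cast hθ
    linarith
  induction a generalizing b with
  | zero =>
    simp only [atLevels, atLevel, covLimit, abs_zero, integral_zero]
    exact ⟨⟨0, le_rfl, by simp⟩, integrableOn_zero, trivial⟩
  | succ i ihi =>
    induction b with
    | zero =>
      have : ∀ m, atLevels (sigmaIntegrand (coreMatrix θ k) ((θ : ℝ) - 1) v m) (i + 1) 0 = 0 :=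
        fun m => by simp [atLevels, atLevel]
      simp only [this, covLimit, abs_zero, integral_zero]
      exact ⟨⟨0, le_rfl, by simp⟩, integrableOn_zero, trivial⟩
    | succ j ihj =>
      obtain ⟨⟨K₁, hK₁, h₁⟩, int₁, eq₁⟩ := ihj (by omega)
      obtain ⟨⟨K₂, hK₂, h₂⟩, int₂, eq₂⟩ := ihi (by omega) hb
      have h := integrableOn_and_integral_of_hasDerivAt
        (c := 1 + 2 * ((θ : ℝ) - 1)) (K := ((θ : ℝ) - 1) * (K₁ + K₂)) (by linarith)
        (by positivity) (hasDerivAt_atLevels_sigmaIntegrand hv ha hb) (fun m hm => ?_)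
        ((int₁.add int₂).const_mul _)
      · refine ⟨h.1, h.2.1, h.2.2.trans ?_⟩
        rw [integral_const_mul, integral_add int₁ int₂, eq₁, eq₂,
          atLevels_succ _ ⟨i, ha⟩ ⟨j, hb⟩, sigmaIntegrand_zero_castSucc hθ hv, covLimit, add_comm]
      · rw [abs_mul, abs_of_nonneg (by linarith : 0 ≤ (θ : ℝ) - 1), mul_assoc, add_mul]
        exact mul_le_mul_of_nonneg_left
          ((abs_add_le _ _).trans (add_le_add (h₁ m hm) (h₂ m hm))) (by linarith)

theorem integrableOn_sigmaIntegrand (hθ : 2 ≤ θ)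
    (hv : IsPrincipalLeftEigenvector (coreMatrix θ k) v) (i j : Fin (k + 1)) :
    IntegrableOn (fun m => sigmaIntegrand (coreMatrix θ k) ((θ : ℝ) - 1) v m i j)
      (Set.Ioi 0) := by
  have hA := coreMatrix_mulVec_one θ k
  -- The last color lies outside the triangular system, but its entries are minus the sum of the
  -- others; this is used once for rows and once for columns.
  have hlast : ∀ {F : ℝ → Fin (k + 1) → ℝ}, (∀ m, ∑ l, F m l = 0) →
      (∀ l : Fin k, IntegrableOn (fun m => F m l.castSucc) (Set.Ioi 0)) →
      ∀ l, IntegrableOn (fun m => F m l) (Set.Ioi 0) := fun {F} hF hint l => by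
    induction l using Fin.lastCases with
    | cast l => exact hint l
    | last =>
      have : (fun m => F m (Fin.last k)) = fun m => -∑ l : Fin k, F m l.castSucc :=
        funext fun m => by
          have := hF m
          rw [Fin.sum_univ_castSucc] at this
          linarith
      rw [this]
      exact (integrable_finsetSum _ fun l _ => hint l).neg
  have hrow : ∀ m i, ∑ l, sigmaIntegrand (coreMatrix θ k) ((θ : ℝ) - 1) v m i l = 0 :=
    fun m i => by
      simpa [Matrix.mulVec, dotProduct] using
        congrFun (sigmaIntegrand_mulVec_one hA hv ((θ : ℝ) - 1) m) i
  have hcol : ∀ m j, ∑ l, sigmaIntegrand (coreMatrix θ k) ((θ : ℝ) - 1) v m l j = 0 :=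
    fun m j => by
      simpa [Matrix.vecMul, dotProduct] using
        congrFun (one_vecMul_sigmaIntegrand hA hv ((θ : ℝ) - 1) m) j
  refine hlast (F := fun m l => sigmaIntegrand (coreMatrix θ k) ((θ : ℝ) - 1) v m l j)
    (fun m => hcol m j) (fun a => ?_) i
  refine hlast (F := fun m l => sigmaIntegrand (coreMatrix θ k) ((θ : ℝ) - 1) v m a.castSucc l)
    (fun m => hrow m _) (fun b => ?_) j
  simp_rw [← atLevels_succ]
  exact (atLevels_sigmaIntegrand_integral hθ hv a.2 b.2).2.1

theorem sigmaInf_eq_covLimit (hθ : 2 ≤ θ)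
    (hv : IsPrincipalLeftEigenvector (coreMatrix θ k) v) (i j : Fin k) :
    sigmaInf θ k v i j = covLimit ((θ : ℝ) - 1) (i + 1) (j + 1) := by
  rw [← (atLevels_sigmaIntegrand_integral hθ hv i.2 j.2).2.2]
  simp_rw [atLevels_succ]
  rfl

end HyperrecursiveTree

end

/-! ### The main theorem -/

theorem mainTheorem2 {Ω : Type*} [MeasurableSpace Ω] (P : MeasureTheory.Measure Ω)
    [MeasureTheory.IsProbabilityMeasure P] (θ k : ℕ) (hθ : 2 ≤ θ) (hk : 1 ≤ k)
    (S : ℕ → Ω → Finset ℕ) (hS : HyperrecursiveTree.IsHyperrecursiveTree P θ S) :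
    (∃! v : Fin (k + 1) → ℝ,
      HyperrecursiveTree.IsPrincipalLeftEigenvector (HyperrecursiveTree.coreMatrix θ k) v) ∧
    ∀ v : Fin (k + 1) → ℝ,
      HyperrecursiveTree.IsPrincipalLeftEigenvector (HyperrecursiveTree.coreMatrix θ k) v →
      (∀ i j : Fin (k + 1), MeasureTheory.IntegrableOn
        (fun m : ℝ => HyperrecursiveTree.sigmaIntegrand (HyperrecursiveTree.coreMatrix θ k)
          ((θ : ℝ) - 1) v m i j) (Set.Ioi 0)) ∧
      ∀ i j : Fin k,
        (fun n : ℕ => HyperrecursiveTree.profileCov P θ S k n i j -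
          (n : ℝ) * HyperrecursiveTree.sigmaInf θ k v i j)
          =o[Filter.atTop] fun n : ℕ => (n : ℝ) := by
  refine ⟨HyperrecursiveTree.existsUnique_principal k hθ, fun v hv =>
    ⟨HyperrecursiveTree.integrableOn_sigmaIntegrand hθ hv, fun i j => ?_⟩⟩
  rw [HyperrecursiveTree.sigmaInf_eq_covLimit hθ hv]
  set σ := HyperrecursiveTree.covLimit ((θ : ℝ) - 1) (i + 1) (j + 1)
  have h := hS.tendsto_levelCov_div hθ (i + 1) (j + 1)
  -- Passes from the normalization by the number `n + θ` of vertices to that by the age `n`.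
  have hθn : Tendsto (fun n : ℕ => (((n + θ : ℕ) : ℝ)) / n) atTop (nhds 1) := by
    have : Tendsto (fun n : ℕ => 1 + (θ : ℝ) / n) atTop (nhds (1 + 0)) :=
      (tendsto_const_div_atTop_nhds_zero_nat _).const_add 1
    rw [add_zero] at this
    refine this.congr' ?_
    filter_upwards [eventually_gt_atTop 0] with n hn
    have : (n : ℝ) ≠ 0 := Nat.cast_ne_zero.2 hn.ne'
    push_cast
    field_simp
  have h2 := (h.mul hθn).sub_const σ
  rw [mul_one, sub_self] at h2
  refine isLittleO_of_tendsto' ?_ (h2.congr' ?_)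
  · filter_upwards [eventually_gt_atTop 0] with n hn h0
    exact absurd h0 (Nat.cast_ne_zero.2 hn.ne')
  · filter_upwards [eventually_gt_atTop 0] with n hn
    have hn' : (n : ℝ) ≠ 0 := Nat.cast_ne_zero.2 hn.ne'
    have ht : ((n + θ : ℕ) : ℝ) ≠ 0 := Nat.cast_ne_zero.2 (by omega)
    have e : HyperrecursiveTree.profileCov P θ S k n i j =
      HyperrecursiveTree.levelCov P θ S n (i + 1) (j + 1) := rfl
    rw [e]
    field_simp
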